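/- Let $T\subset\mathbb R$ be a non-degenerate interval, let $K:T\times T\to\mathbb R$ be a continuous positive semi-definite kernel with $K(t,t)=1$ for all $t\in T$, and let $P$ be the centered Gaussian probability measure on $\mathbb R^T$ with covariance function $K$. Notation. For $t\in T\setminus\{\sup T\}$ and $h>0$ with $t+h\in T$ put $L^K_t(h)=h^{-1}\bigl(1-K(t,t+h)\bigr)$; if $\alpha^K(t)=\lim_{h\to0^+}L^K_t(h)$ exists in $\mathbb R$ for every $t\in T\setminus\{\sup T\}$, the function $\alpha^K:T\setminus\{\sup T\}\to\mathbb R_+$ is said to be well defined. For $s<t$ in $T$ and $\eta>0$ let $$C_{s,t}(\eta)=\{(v,h): v\in[s,t),\ v+h\in[s,t],\ h\in(0,\eta]\}.$$ For a measurable $\alpha$ with values in $[0,+\infty]$, defined on $T$ or on $T\setminus\{\sup T\}$, let $P_\alpha$ be the centered Gaussian probability measure on $\mathbb R^T$ with covariance function $K_\alpha(s,t)=\exp\bigl(-\int_{\min(s,t)}^{\max(s,t)}\alpha(u)\,du\bigr)$, a Lebesgue integral with values in $[0,+\infty]$, with $\exp(-\infty)=0$; in particular $P_{+\infty}$ has covariance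 function $1_{\{s=t\}}$ (it is the law of a family of i.i.d. standard normal variables). For a probability measure $Q$ on $\mathbb R^T$, let $Q^{t_0,\dots,t_n}$ be its marginal at the times $t_0,\dots,t_n$. For $t_0<\dots<t_n$ in $T$, the concatenation $Q^{t_0,t_1}\circ\dots\circ Q^{t_{n-1},t_n}$ is the law on $\mathbb R^{n+1}$ of the Markov chain with initial law $Q^{t_0}$ whose $i$-th transition kernel is the conditional law of the second coordinate given the first under $Q^{t_{i-1},t_i}$. $Q$ is a Markov measure if $Q^{t_0,\dots,t_n}$ equals this concatenation for all $t_0<\dots<t_n$ in $T$. For a partition $R=(s=t_0<\dots<t_n=t)$ of $[s,t]$, $Q^{s,t}_{\{R\}}$ denotes the law of the first and last coordinates under $Q^{t_0,t_1}\circ\dots\circ Q^{t_{n-1},t_n}$. A probability measure $P'$ on $\mathbb R^T$ is a strong local Markov transform of $P$ if $P'$ is a Markov measure and, for all $s<t$ in $T$ and every sequence $(R_n)$ of partitions of $[s,t]$ with mesh tending to $0$, $P^{s,t}_{\{R_n\}}\to P'^{s,t}$ weakly; it is *the* strong local Markov transform if moreover it is the only one. Theorem. 1. Assume that $\alpha^K$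 is well defined and continuous on $T\setminus\{\sup T\}$ and that, for all $s<t$ in $T$, $\sup_{(v,h)\in C_{s,t}(\eta)}|L^K_v(h)-\alpha^K(v)|\to0$ as $\eta\to0^+$. Then $P_{\alpha^K}$ exists and is the strong local Markov transform of $P$. 2. Assume that, for all $s<t$ in $T$, $\inf_{(v,h)\in C_{s,t}(\eta)}L^K_v(h)\to+\infty$ as $\eta\to0^+$. Then $P_{+\infty}$ exists and is the strong local Markov transform of $P$. -/

import Mathlib

open MeasureTheory ProbabilityTheory Filter Topology
open scoped ENNReal

noncomputable section

/-! ### Concatenation and composition of transport plans -/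

/-- The concatenation `Q₀ ∘ ⋯ ∘ Qₙ₋₁` of the plans `Qᵢ` on `ℝ × ℝ`, with initial law `μ`
(the first marginal of `Q₀`):
`μ(dx₀) k₀(x₀, dx₁) ⋯ kₙ₋₁(xₙ₋₁, dxₙ)`, where `kᵢ` disintegrates `Qᵢ` with respect to its first
marginal. For `n = 0` it is `μ` itself. -/
def concatenation (μ : ProbabilityMeasure ℝ) :
    (n : ℕ) → (Fin n → ProbabilityMeasure (ℝ × ℝ)) → ProbabilityMeasure (Fin (n + 1) → ℝ)
  | 0, _ => μ.map (f := fun x (_ : Fin 1) => x)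
      (measurable_pi_lambda _ fun _ => measurable_id).aemeasurable
  | n + 1, Q =>
      ⟨((concatenation μ n (fun i => Q i.castSucc) : Measure (Fin (n + 1) → ℝ)) ⊗ₘ
          ((Q (Fin.last n) : Measure (ℝ × ℝ)).condKernel.comap
            (fun x : Fin (n + 1) → ℝ => x (Fin.last n)) (measurable_pi_apply _))).map
        (fun p => Fin.snoc (α := fun _ => ℝ) p.1 p.2),
      Measure.isProbabilityMeasure_map (by
        refine (measurable_pi_lambda _ fun i => ?_).aemeasurable
        refine Fin.lastCases ?_ (fun j => ?_) i
        · simpa using measurable_snd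
        · simpa using (show Measurable fun c : (Fin (n + 1) → ℝ) × ℝ => c.1 j from
            (measurable_pi_apply j).comp measurable_fst))⟩

/-- The law `P^t` of the time-`t` marginal. -/
def marginalLaw {T : Set ℝ} (P : ProbabilityMeasure (T → ℝ)) (t : T) : ProbabilityMeasure ℝ :=
  P.map (f := fun ω => ω t) (measurable_pi_apply t).aemeasurable

/-- The two-dimensional law `P^{s,t}`. -/
def pairLaw {T : Set ℝ} (P : ProbabilityMeasure (T → ℝ)) (s t : T) :
    ProbabilityMeasure (ℝ × ℝ) :=
  P.map (f := fun ω => (ω s, ω t))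
    ((measurable_pi_apply s).prodMk (measurable_pi_apply t)).aemeasurable

/-- The finite-dimensional law `P^{t₀,…,tₙ}`. -/
def finiteLaw {T : Set ℝ} (P : ProbabilityMeasure (T → ℝ)) {n : ℕ} (t : Fin (n + 1) → T) :
    ProbabilityMeasure (Fin (n + 1) → ℝ) :=
  P.map (f := fun ω i => ω (t i))
    (measurable_pi_lambda _ fun i => measurable_pi_apply (t i)).aemeasurable

/-- The concatenation `P^{t₀,t₁} ∘ ⋯ ∘ P^{tₙ₋₁,tₙ}`. -/
def concatenatedLaw {T : Set ℝ} (P : ProbabilityMeasure (T → ℝ)) {n : ℕ} (t : Fin (n + 1) → T) :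
    ProbabilityMeasure (Fin (n + 1) → ℝ) :=
  concatenation (marginalLaw P (t 0)) n (fun i => pairLaw P (t i.castSucc) (t i.succ))

/-- `P` is a Markov measure: `P^{t₀,…,tₙ} = P^{t₀,t₁} ∘ ⋯ ∘ P^{tₙ₋₁,tₙ}` for all
`t₀ < ⋯ < tₙ` in `T`. -/
def IsMarkovMeasure {T : Set ℝ} (P : ProbabilityMeasure (T → ℝ)) : Prop :=
  ∀ (n : ℕ) (t : Fin (n + 1) → T), StrictMono t → finiteLaw P t = concatenatedLaw P t

/-! ### Local Markov transform -/

/-- A partition `s = t₀ < ⋯ < tₙ = t` of `[s, t]`. -/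
structure TimePartition {T : Set ℝ} (s t : T) where
  /-- the number of subintervals -/
  size : ℕ
  /-- the points of the partition -/
  pts : Fin (size + 1) → T
  strictMono : StrictMono pts
  first_eq : pts 0 = s
  last_eq : pts (Fin.last size) = t

/-- The mesh of a partition. -/
def TimePartition.mesh {T : Set ℝ} {s t : T} (R : TimePartition s t) : ℝ :=
  ⨆ i : Fin R.size, |(R.pts i.succ : ℝ) - (R.pts i.castSucc : ℝ)|

/-- The composition `P_{R}^{s,t} = P^{t₀,t₁} · ⋯ · P^{tₙ₋₁,tₙ}` along a partition `R` of `[s, t]`: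
the law of the first and last coordinates under the concatenation. -/
def composedLaw {T : Set ℝ} (P : ProbabilityMeasure (T → ℝ)) {s t : T} (R : TimePartition s t) :
    ProbabilityMeasure (ℝ × ℝ) :=
  (concatenatedLaw P R.pts).map (f := fun x => (x 0, x (Fin.last R.size)))
    ((measurable_pi_apply _).prodMk (measurable_pi_apply _)).aemeasurable

/-- `P'` is a strong local Markov transform of `P`: it is a Markov measure and, for all `s < t`
in `T` and every sequence of partitions of `[s, t]` whose mesh tends to `0`, the composed laws
converge weakly to `P'^{s,t}`. -/
def IsStrongLocalMarkovTransform {T : Set ℝ} (P P' : ProbabilityMeasure (T → ℝ)) : Prop :=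
  IsMarkovMeasure P' ∧
    ∀ s t : T, s < t → ∀ R : ℕ → TimePartition s t,
      Tendsto (fun n => (R n).mesh) atTop (𝓝 0) →
        Tendsto (fun n => composedLaw P (R n)) atTop (𝓝 (pairLaw P' s t))

/-- `P'` is *the* strong local Markov transform of `P`: it is one, and it is the only one. -/
def IsTheStrongLocalMarkovTransform {T : Set ℝ} (P P' : ProbabilityMeasure (T → ℝ)) : Prop :=
  IsStrongLocalMarkovTransform P P' ∧ ∀ Q, IsStrongLocalMarkovTransform P Q → Q = P'

/-! ### Covariance kernels and Gaussian measures

A kernel on `T` is given as a function on `ℝ × ℝ`, of which only the values on `T × T` matter. -/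

/-- `K` is a positive semi-definite kernel on `T`. -/
def IsPosSemidefKernel (T : Set ℝ) (K : ℝ → ℝ → ℝ) : Prop :=
  ∀ (m : ℕ) (t : Fin m → T), (Matrix.of fun i j => K (t i) (t j)).PosSemidef

/-- `P` is the centered Gaussian measure on `ℝ^T` with covariance function `K`. -/
structure IsCenteredGaussianMeasure (T : Set ℝ) (K : ℝ → ℝ → ℝ)
    (P : ProbabilityMeasure (T → ℝ)) : Prop where
  gaussian : IsGaussianProcess (fun (t : T) (ω : T → ℝ) => ω t) (P : Measure (T → ℝ))
  centered : ∀ t : T, ∫ ω, ω t ∂(P : Measure (T → ℝ)) = 0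
  cov : ∀ s t : T,
    covariance (fun ω : T → ℝ => ω s) (fun ω : T → ℝ => ω t) (P : Measure (T → ℝ)) = K s t

/-- The correlation function `c_K` of `K`. -/
def correlationFn (K : ℝ → ℝ → ℝ) (s t : ℝ) : ℝ :=
  (√(K s s))⁻¹ * (√(K t t))⁻¹ * K s t

/-- The decay rate `L^K_t(h) = (1 - c_K(t, t + h)) / h` of the correlation of `K` at `t`. -/
def decayRate (K : ℝ → ℝ → ℝ) (t h : ℝ) : ℝ :=
  h⁻¹ * (1 - correlationFn K t (t + h))

/-- `T` without its largest element `sup T` (if it has one). -/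
def withoutSup (T : Set ℝ) : Set ℝ := {t ∈ T | ∃ u ∈ T, t < u}

/-- The instantaneous decorrelation rate of `K` is well defined, and equal to `α`
on `T ∖ {sup T}`. -/
def IsInstantaneousDecorrelationRate (T : Set ℝ) (K : ℝ → ℝ → ℝ) (α : ℝ → ℝ) : Prop :=
  ∀ t ∈ withoutSup T, Tendsto (decayRate K t) (𝓝[>] 0) (𝓝 (α t))

/-- The set `C_{s,t}(η)` of the `(v, h)` with `v ∈ [s, t)`, `v + h ∈ [s, t]` and `h ∈ (0, η]`. -/
def incrementSet (s t η : ℝ) : Set (ℝ × ℝ) :=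
  {p | p.1 ∈ Set.Ico s t ∧ p.1 + p.2 ∈ Set.Icc s t ∧ p.2 ∈ Set.Ioc 0 η}

/-- The kernel `K_α(s, t) = exp (-∫_{min(s,t)}^{max(s,t)} α(u) du)` of `α : ℝ → [0, ∞]`, with the
convention `exp (-∞) = 0`. -/
def expKernel (α : ℝ → ℝ≥0∞) (s t : ℝ) : ℝ :=
  (EReal.exp (-((∫⁻ u in Set.Icc (min s t) (max s t), α u : ℝ≥0∞) : EReal))).toReal

end

open MeasureTheory ProbabilityTheory Filter Topology
open scoped ENNReal

noncomputable section

/-! A standardized Gaussian pair with correlation `r` is the law of `(X, r X + √(1 - r²) Z)`, with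
`X`, `Z` independent standard normals (`stdPair`). Concatenating such pairs gives a Gaussian
autoregressive chain, and composing them multiplies correlations. Hence the composed law along a
partition is `stdPair (∏ K(tᵢ, tᵢ₊₁))` (`IsCenteredGaussianMeasure.composedLaw_eq`), and, `stdPair`
being continuous in `r`, its weak convergence follows from that of a product of numbers to `K_α(s,
t)`.

By uniform continuity of `K` on `[s, t]²` and `K(t, t) = 1`, the defects `qᵢ = 1 - K(tᵢ, tᵢ₊₁)`
become uniformly small with the mesh, so the product behaves like `exp (-∑ qᵢ)`
(`tendsto_prod_one_sub`). It remains to show `∑ qᵢ → ∫ α` in `[0, ∞]`. When the decay rate tends to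
infinity, `∑ qᵢ` is at least `t - s` times a lower bound for the rate. When it converges uniformly
to `α`, `∑ qᵢ` differs by a vanishing amount from a left Riemann sum of `α`. Continuity of `α` is
only known on `[s, t)` when `t = sup T`, so convergence of these sums is not automatic. Positive
semi-definiteness supplies the missing control: `1 - K(u, w) ≤ 2 (1 - K(u, v)) + 2 (1 - K(v, w))`
yields `α v ≤ 4 α w + 7` for `w` slightly to the right of `v`, which bounds the tails of the Riemann
sums by those of the integral (`tendsto_sum_left`).

The limit measure exists because `K_α` is multiplicative, `K(r, t) = K(r, s) K(s, t)` for `r ≤ s ≤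
t`. This makes it positive semi-definite (`sq_sum_le_of_multiplicative`), and a Gaussian measure is
then built from an isonormal process. Multiplicativity is also what makes that measure Markov.
Uniqueness holds because the limits fix the two-dimensional laws, which determine a Markov measure.
-/

/-! ### Characteristic functions of centered Gaussian vectors -/

/-- The law `μ` on `ℝ^ι` has the characteristic function of the centered Gaussian vector with
covariance matrix `C`. -/
def HasNormalCharFun {ι : Type*} [Fintype ι] (μ : Measure (ι → ℝ)) (C : ι → ι → ℝ) : Prop :=
  ∀ a : ι → ℝ, ∫ x, Complex.exp ((∑ j, a j * x j : ℝ) * Complex.I) ∂μ =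
    Complex.exp ((-(∑ j, ∑ k, a j * a k * C j k) / 2 : ℝ))

lemma HasNormalCharFun.measure_eq {ι : Type*} [Fintype ι] {μ ν : Measure (ι → ℝ)}
    [IsFiniteMeasure μ] [IsFiniteMeasure ν] {C : ι → ι → ℝ} (hμ : HasNormalCharFun μ C)
    (hν : HasNormalCharFun ν C) : μ = ν := by
  classical
  refine Measure.ext_of_charFunDual (funext fun L => ?_)
  have hL : ∀ x : ι → ℝ, L x = ∑ j, L (Pi.single j 1) * x j := fun x => by
    conv_lhs => rw [← Finset.univ_sum_single x, map_sum]
    refine Finset.sum_congr rfl fun j _ => ?_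
    have : Pi.single j (x j) = x j • (Pi.single j 1 : ι → ℝ) := by
      rw [← Pi.single_smul, smul_eq_mul, mul_one]
    rw [this, map_smul, smul_eq_mul, mul_comm]
  have e : ∀ ρ : Measure (ι → ℝ), charFunDual ρ L =
      ∫ x, Complex.exp ((∑ j, L (Pi.single j 1) * x j : ℝ) * Complex.I) ∂ρ := fun ρ => by
    rw [charFunDual_apply]
    exact integral_congr_ae (.of_forall fun x => by simp only; rw [hL x])
  rw [e, e, hμ, hν]

lemma HasNormalCharFun.map_eval {ι : Type*} [Fintype ι] {μ : Measure (ι → ℝ)}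
    [IsFiniteMeasure μ] {C : ι → ι → ℝ} (hμ : HasNormalCharFun μ C) (i : ι) (hC : C i i = 1) :
    μ.map (fun x => x i) = gaussianReal 0 1 := by
  classical
  refine Measure.ext_of_charFun (funext fun t => ?_)
  rw [charFun_gaussianReal, charFun_apply_real,
    integral_map (measurable_pi_apply i).aemeasurable (by fun_prop)]
  have := hμ (Pi.single i t)
  simp only [Pi.single_apply, ite_mul, mul_ite, zero_mul, mul_zero, Finset.sum_ite_eq',
    Finset.mem_univ, if_true, hC] at this
  push_cast at this
  rw [this]
  congr 1
  simp
  ring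

/-- A real centered Gaussian variable with variance `v` has characteristic function
`exp (-v t² / 2)` at `t = 1`. -/
lemma integral_cexp_gaussianReal (v : NNReal) :
    ∫ x, Complex.exp ((x : ℝ) * Complex.I) ∂(gaussianReal 0 v) =
      Complex.exp ((-(v : ℝ) / 2 : ℝ)) := by
  have := charFun_gaussianReal (μ := 0) (v := v) 1
  rw [charFun_apply_real] at this
  simp only [Complex.ofReal_one, one_mul] at this
  rw [this]
  congr 1
  simp
  ring

lemma integral_cexp_mul_gaussianReal (b : ℝ) :
    ∫ x, Complex.exp ((b * x : ℝ) * Complex.I) ∂(gaussianReal 0 1) =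
      Complex.exp ((-b ^ 2 / 2 : ℝ)) := by
  have := charFun_gaussianReal (μ := 0) (v := 1) b
  rw [charFun_apply_real] at this
  push_cast at this ⊢
  rw [this]
  congr 1
  simp
  ring

lemma IsCenteredGaussianMeasure.integral_cexp {T : Set ℝ} {K : ℝ → ℝ → ℝ}
    {P : ProbabilityMeasure (T → ℝ)} (hP : IsCenteredGaussianMeasure T K P)
    {ι : Type*} [Fintype ι] (t : ι → T) (a : ι → ℝ) :
    ∫ ω, Complex.exp ((∑ j, a j * ω (t j) : ℝ) * Complex.I) ∂(P : Measure (T → ℝ)) =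
      Complex.exp ((-(∑ j, ∑ k, a j * a k * K (t j) (t k)) / 2 : ℝ)) := by
  have hX : IsGaussianProcess (fun (j : ι) (ω : T → ℝ) => a j • ω (t j))
      (P : Measure (T → ℝ)) := (hP.gaussian.comp_right t).smul a
  have hS : HasGaussianLaw (fun ω : T → ℝ => ∑ j, a j • ω (t j)) (P : Measure (T → ℝ)) :=
    hX.hasGaussianLaw_fun_sum (I := Finset.univ)
  have hmean : ∫ ω, ∑ j, a j • ω (t j) ∂(P : Measure (T → ℝ)) = 0 := by
    rw [integral_finsetSum _ fun j _ => (hX.hasGaussianLaw_eval j).integrable]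
    refine Finset.sum_eq_zero fun j _ => ?_
    rw [integral_smul, hP.centered, smul_zero]
  have hvar : Var[fun ω : T → ℝ => ∑ j, a j • ω (t j); (P : Measure (T → ℝ))] =
      ∑ j, ∑ k, a j * a k * K (t j) (t k) := by
    rw [variance_fun_sum fun j => (hX.hasGaussianLaw_eval j).memLp_two]
    refine Finset.sum_congr rfl fun j _ => Finset.sum_congr rfl fun k _ => ?_
    simp only [smul_eq_mul]
    rw [covariance_const_mul_left, covariance_const_mul_right, hP.cov, mul_assoc]
  have hlaw := hS.map_eq_gaussianReal
  rw [hmean, hvar] at hlaw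
  have hnn : 0 ≤ ∑ j, ∑ k, a j * a k * K (t j) (t k) := hvar ▸ variance_nonneg _ _
  have := integral_cexp_gaussianReal (∑ j, ∑ k, a j * a k * K (t j) (t k)).toNNReal
  rw [← hlaw, integral_map hS.aemeasurable (by fun_prop), Real.coe_toNNReal _ hnn] at this
  simpa only [smul_eq_mul] using this

lemma IsCenteredGaussianMeasure.hasNormalCharFun_finiteLaw {T : Set ℝ} {K : ℝ → ℝ → ℝ}
    {P : ProbabilityMeasure (T → ℝ)} (hP : IsCenteredGaussianMeasure T K P)
    {n : ℕ} (t : Fin (n + 1) → T) :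
    HasNormalCharFun (finiteLaw P t : Measure (Fin (n + 1) → ℝ)) fun j k => K (t j) (t k) := by
  intro a
  rw [finiteLaw, ProbabilityMeasure.toMeasure_map,
    integral_map (measurable_pi_lambda _ fun i => measurable_pi_apply (t i)).aemeasurable
      (Continuous.aestronglyMeasurable (by fun_prop))]
  exact hP.integral_cexp t a

/-! ### Standard Gaussian pairs -/

/-- The law of `(X, r X + √(1 - r²) Z)` for independent standard normal variables `X`, `Z`. -/
def stdPair (r : ℝ) : ProbabilityMeasure (ℝ × ℝ) :=
  ⟨((gaussianReal 0 1).prod (gaussianReal 0 1)).map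
    fun p : ℝ × ℝ => (p.1, r * p.1 + √(1 - r ^ 2) * p.2),
    Measure.isProbabilityMeasure_map (by fun_prop)⟩

lemma integral_cexp_stdPair {r : ℝ} (hr : |r| ≤ 1) (a b : ℝ) :
    ∫ p, Complex.exp ((a * p.1 + b * p.2 : ℝ) * Complex.I) ∂(stdPair r : Measure (ℝ × ℝ)) =
      Complex.exp ((-(a ^ 2 + 2 * a * b * r + b ^ 2) / 2 : ℝ)) := by
  rw [stdPair, ProbabilityMeasure.coe_mk, integral_map (by fun_prop) (by fun_prop)]
  have : ∀ p : ℝ × ℝ, Complex.exp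
      ((a * p.1 + b * (r * p.1 + √(1 - r ^ 2) * p.2) : ℝ) * Complex.I) =
      Complex.exp (((a + b * r) * p.1 : ℝ) * Complex.I) *
        Complex.exp (((b * √(1 - r ^ 2)) * p.2 : ℝ) * Complex.I) := fun p => by
    rw [← Complex.exp_add, ← add_mul, ← Complex.ofReal_add]
    ring_nf
  simp_rw [this]
  rw [integral_prod_mul (fun x : ℝ => Complex.exp (((a + b * r) * x : ℝ) * Complex.I))
    (fun x : ℝ => Complex.exp (((b * √(1 - r ^ 2)) * x : ℝ) * Complex.I)),
    integral_cexp_mul_gaussianReal, integral_cexp_mul_gaussianReal, ← Complex.exp_add,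
    ← Complex.ofReal_add, mul_pow, Real.sq_sqrt (by nlinarith [sq_abs r, abs_nonneg r])]
  ring_nf

lemma eq_stdPair {μ : ProbabilityMeasure (ℝ × ℝ)} {r : ℝ} (hr : |r| ≤ 1)
    (h : ∀ a b : ℝ, ∫ p, Complex.exp ((a * p.1 + b * p.2 : ℝ) * Complex.I)
      ∂(μ : Measure (ℝ × ℝ)) = Complex.exp ((-(a ^ 2 + 2 * a * b * r + b ^ 2) / 2 : ℝ))) :
    μ = stdPair r := by
  refine ProbabilityMeasure.toMeasure_injective (Measure.ext_of_charFunDual (funext fun L => ?_))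
  have hL : ∀ p : ℝ × ℝ, L p = L (1, 0) * p.1 + L (0, 1) * p.2 := fun p => by
    have : p = p.1 • ((1 : ℝ), (0 : ℝ)) + p.2 • ((0 : ℝ), (1 : ℝ)) := by ext <;> simp
    conv_lhs => rw [this, map_add, map_smul, map_smul, smul_eq_mul, smul_eq_mul]
    ring
  have e : ∀ ρ : Measure (ℝ × ℝ), charFunDual ρ L =
      ∫ p, Complex.exp ((L (1, 0) * p.1 + L (0, 1) * p.2 : ℝ) * Complex.I) ∂ρ := fun ρ => by
    rw [charFunDual_apply]
    exact integral_congr_ae (.of_forall fun p => by simp only; rw [hL p])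
  rw [e, e]
  exact (h _ _).trans (integral_cexp_stdPair hr _ _).symm

/-- All the laws are images of one fixed product measure under maps depending continuously on `r`,
so dominated convergence applies. No bound on `r` is needed, since `√` is continuous on all of `ℝ`,
being `0` on negative numbers. -/
lemma tendsto_stdPair {r : ℕ → ℝ} {s : ℝ} (h : Tendsto r atTop (𝓝 s)) :
    Tendsto (fun n => stdPair (r n)) atTop (𝓝 (stdPair s)) := by
  rw [ProbabilityMeasure.tendsto_iff_forall_integral_tendsto]
  intro f
  simp only [stdPair, ProbabilityMeasure.coe_mk]
  simp_rw [fun q : ℝ => integral_map (μ := (gaussianReal 0 1).prod (gaussianReal 0 1))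
    (φ := fun p : ℝ × ℝ => (p.1, q * p.1 + √(1 - q ^ 2) * p.2)) (by fun_prop)
    (f.continuous.aestronglyMeasurable)]
  refine tendsto_integral_of_dominated_convergence (fun _ => ‖f‖) (fun n => ?_)
    (integrable_const _) (fun n => .of_forall fun p => f.norm_coe_le_norm _)
    (.of_forall fun p => ?_)
  · exact (f.continuous.comp (by fun_prop)).aestronglyMeasurable
  · have hc : Continuous fun q : ℝ => f (p.1, q * p.1 + √(1 - q ^ 2) * p.2) :=
      f.continuous.comp (by fun_prop)
    exact (hc.tendsto s).comp h

lemma map_fst_stdPair (r : ℝ) : (stdPair r : Measure (ℝ × ℝ)).fst = gaussianReal 0 1 := by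
  rw [Measure.fst, stdPair, ProbabilityMeasure.coe_mk, Measure.map_map (by fun_prop) (by fun_prop)]
  exact Measure.fst_prod

/-- The variances of `X_s + X_t` and `X_s - X_t` are `2 + 2 K(s, t)` and `2 - 2 K(s, t)`, both
nonnegative. -/
lemma IsCenteredGaussianMeasure.abs_le_one {T : Set ℝ} {K : ℝ → ℝ → ℝ}
    {P : ProbabilityMeasure (T → ℝ)} (hP : IsCenteredGaussianMeasure T K P)
    (hK : ∀ t ∈ T, K t t = 1) (s t : T) : |K s t| ≤ 1 := by
  have hs := (hP.gaussian.hasGaussianLaw_eval s).memLp_two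
  have ht := (hP.gaussian.hasGaussianLaw_eval t).memLp_two
  have hvar : ∀ u : T, Var[fun ω : T → ℝ => ω u; (P : Measure (T → ℝ))] = 1 := fun u => by
    rw [← covariance_self (measurable_pi_apply u).aemeasurable, hP.cov, hK u u.2]
  have h1 := variance_add hs ht
  have h2 := variance_sub hs ht
  rw [hvar, hvar, hP.cov] at h1 h2
  have h1' := variance_nonneg ((fun ω : T → ℝ => ω s) + fun ω : T → ℝ => ω t)
    (P : Measure (T → ℝ))
  have h2' := variance_nonneg ((fun ω : T → ℝ => ω s) - fun ω : T → ℝ => ω t)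
    (P : Measure (T → ℝ))
  rw [abs_le]
  constructor <;> linarith

lemma IsCenteredGaussianMeasure.symm {T : Set ℝ} {K : ℝ → ℝ → ℝ}
    {P : ProbabilityMeasure (T → ℝ)} (hP : IsCenteredGaussianMeasure T K P)
    (s t : T) : K s t = K t s := by
  rw [← hP.cov, covariance_comm, hP.cov]

lemma IsCenteredGaussianMeasure.pairLaw_eq {T : Set ℝ} {K : ℝ → ℝ → ℝ}
    {P : ProbabilityMeasure (T → ℝ)} (hP : IsCenteredGaussianMeasure T K P)
    (hK : ∀ t ∈ T, K t t = 1) (s t : T) : pairLaw P s t = stdPair (K s t) := by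
  refine eq_stdPair (hP.abs_le_one hK s t) fun a b => ?_
  rw [pairLaw, ProbabilityMeasure.toMeasure_map, integral_map (by fun_prop) (by fun_prop)]
  have := hP.integral_cexp ![s, t] ![a, b]
  simp only [Fin.sum_univ_two, Matrix.cons_val_zero, Matrix.cons_val_one, hK s s.2, hK t t.2,
    hP.symm t s] at this
  rw [this]
  ring_nf

lemma IsCenteredGaussianMeasure.marginalLaw_eq {T : Set ℝ} {K : ℝ → ℝ → ℝ}
    {P : ProbabilityMeasure (T → ℝ)} (hP : IsCenteredGaussianMeasure T K P)
    (hK : ∀ t ∈ T, K t t = 1) (t : T) :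
    (marginalLaw P t : Measure ℝ) = gaussianReal 0 1 := by
  rw [← map_fst_stdPair (K t t), ← hP.pairLaw_eq hK t t, Measure.fst, pairLaw, marginalLaw,
    ProbabilityMeasure.toMeasure_map, ProbabilityMeasure.toMeasure_map,
    Measure.map_map (by fun_prop) (by fun_prop)]
  rfl

/-! ### Concatenation of standard Gaussian pairs -/

/-- The transition kernel `x ↦ law of (r x + √(1 - r²) Z)`, `Z` standard normal. -/
def autoregressiveKernel (r : ℝ) : Kernel ℝ ℝ :=
  (Kernel.id ×ₖ Kernel.const ℝ (gaussianReal 0 1)).map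
    fun p : ℝ × ℝ => r * p.1 + √(1 - r ^ 2) * p.2

lemma autoregressiveKernel_apply (r x : ℝ) : autoregressiveKernel r x =
    (gaussianReal 0 1).map fun z => r * x + √(1 - r ^ 2) * z := by
  rw [autoregressiveKernel, Kernel.map_apply _ (by fun_prop), Kernel.prod_apply, Kernel.id_apply,
    Kernel.const_apply, Measure.dirac_prod, Measure.map_map (by fun_prop) (by fun_prop)]
  rfl

instance (r : ℝ) : IsMarkovKernel (autoregressiveKernel r) :=
  Kernel.IsMarkovKernel.map _ (by fun_prop)

/-- The map `g` allows the past to be a whole vector of which only the last coordinate drives the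
transition; `g = id` gives `stdPair`. -/
lemma compProd_comap_autoregressiveKernel {X : Type*} [MeasurableSpace X] (μ : Measure X)
    [SFinite μ] {g : X → ℝ} (hg : Measurable g) (r : ℝ) :
    μ ⊗ₘ (autoregressiveKernel r).comap g hg =
      (μ.prod (gaussianReal 0 1)).map fun p => (p.1, r * g p.1 + √(1 - r ^ 2) * p.2) := by
  have hm : Measurable fun p : X × ℝ => (p.1, r * g p.1 + √(1 - r ^ 2) * p.2) := by fun_prop
  ext s hs
  rw [Measure.compProd_apply hs, Measure.map_apply hm hs, Measure.prod_apply (hm hs)]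
  refine lintegral_congr fun x => ?_
  rw [Kernel.comap_apply, autoregressiveKernel_apply,
    Measure.map_apply (by fun_prop) (measurable_prodMk_left hs)]
  rfl

lemma stdPair_eq_compProd (r : ℝ) :
    (stdPair r : Measure (ℝ × ℝ)) = gaussianReal 0 1 ⊗ₘ autoregressiveKernel r :=
  (compProd_comap_autoregressiveKernel (gaussianReal 0 1) measurable_id r).symm

lemma condKernel_stdPair (r : ℝ) :
    (stdPair r : Measure (ℝ × ℝ)).condKernel =ᵐ[gaussianReal 0 1] autoregressiveKernel r := by
  have h := eq_condKernel_of_measure_eq_compProd (ρ := (stdPair r : Measure (ℝ × ℝ)))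
    (autoregressiveKernel r) (by rw [map_fst_stdPair, ← stdPair_eq_compProd])
  rw [map_fst_stdPair] at h
  filter_upwards [h] with x hx using hx.symm

lemma measurable_snoc (n : ℕ) : Measurable fun p : (Fin n → ℝ) × ℝ =>
    (Fin.snoc (α := fun _ => ℝ) p.1 p.2 : Fin (n + 1) → ℝ) := by
  refine measurable_pi_lambda _ fun i => ?_
  refine Fin.lastCases ?_ (fun j => ?_) i
  · simpa using measurable_snd
  · simpa using (show Measurable fun p : (Fin n → ℝ) × ℝ => p.1 j from
      (measurable_pi_apply j).comp measurable_fst)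

/-- The disintegration kernel of `stdPair r` is the autoregressive kernel only almost everywhere for
the standard normal law. Hence the hypothesis `hlast`: the null set is pulled back along the last
coordinate. -/
lemma concatenation_succ_stdPair (μ : ProbabilityMeasure ℝ) {n : ℕ}
    (Q : Fin (n + 1) → ProbabilityMeasure (ℝ × ℝ)) {r : ℝ} (hQ : Q (Fin.last n) = stdPair r)
    (hlast : (concatenation μ n (fun i => Q i.castSucc) : Measure (Fin (n + 1) → ℝ)).map
      (fun x => x (Fin.last n)) = gaussianReal 0 1) :
    (concatenation μ (n + 1) Q : Measure (Fin (n + 2) → ℝ)) =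
      ((concatenation μ n (fun i => Q i.castSucc) : Measure (Fin (n + 1) → ℝ)).prod
        (gaussianReal 0 1)).map fun p => Fin.snoc (α := fun _ => ℝ) p.1
          (r * p.1 (Fin.last n) + √(1 - r ^ 2) * p.2) := by
  have hm : Measurable fun x : Fin (n + 1) → ℝ => x (Fin.last n) := measurable_pi_apply _
  rw [concatenation, ProbabilityMeasure.coe_mk]
  have hae : ((Q (Fin.last n) : Measure (ℝ × ℝ)).condKernel.comap
      (fun x : Fin (n + 1) → ℝ => x (Fin.last n)) hm) =ᵐ[(concatenation μ n
        (fun i => Q i.castSucc) : Measure (Fin (n + 1) → ℝ))] (autoregressiveKernel r).comap _ hm := by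
    have h := condKernel_stdPair r
    rw [← hlast, ← hQ] at h
    filter_upwards [ae_of_ae_map hm.aemeasurable h] with x hx
    rw [Kernel.comap_apply, Kernel.comap_apply, hx]
  rw [Measure.compProd_congr hae, compProd_comap_autoregressiveKernel _ hm,
    Measure.map_map (measurable_snoc _) (by fun_prop)]
  rfl

/-- Substituting `x_{n+1} = r x_n + √(1 - r²) z` into `∑ aⱼ xⱼ` adds `a_{n+1} r` to the coefficient
of `x_n` and leaves an independent term of variance `a_{n+1}² (1 - r²)`. This is the resulting
identity of variances. -/
lemma sum_snoc_quadratic {n : ℕ} {r : ℝ} {C : Fin (n + 2) → Fin (n + 2) → ℝ}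
    (hdiag : ∀ j, C j j = 1) (hsymm : ∀ j k, C j k = C k j)
    (hC : ∀ j : Fin (n + 1), C j.castSucc (Fin.last (n + 1)) =
      r * C j.castSucc (Fin.last n).castSucc) (a : Fin (n + 2) → ℝ) :
    ∑ j, ∑ k, a j * a k * C j k =
      (∑ j : Fin (n + 1), ∑ k : Fin (n + 1),
        (a j.castSucc + if j = Fin.last n then a (Fin.last (n + 1)) * r else 0) *
        (a k.castSucc + if k = Fin.last n then a (Fin.last (n + 1)) * r else 0) *
          C j.castSucc k.castSucc) + a (Fin.last (n + 1)) ^ 2 * (1 - r ^ 2) := by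
  simp only [add_mul, mul_add, Finset.sum_add_distrib, ite_mul, mul_ite, zero_mul, mul_zero,
    Finset.sum_ite_eq', Finset.mem_univ, if_true,
    Fin.sum_univ_castSucc (n := n + 1), hdiag, hC, fun j : Fin (n + 1) =>
      (hsymm (Fin.last (n + 1)) j.castSucc).trans (hC j)]
  have h1 : ∑ j : Fin (n + 1), a j.castSucc * a (Fin.last (n + 1)) *
      (r * C j.castSucc (Fin.last n).castSucc) =
      ∑ j : Fin (n + 1), a j.castSucc * (a (Fin.last (n + 1)) * r) *
        C j.castSucc (Fin.last n).castSucc := Finset.sum_congr rfl fun j _ => by ring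
  have h2 : ∑ j : Fin (n + 1), a (Fin.last (n + 1)) * a j.castSucc *
      (r * C j.castSucc (Fin.last n).castSucc) =
      ∑ j : Fin (n + 1), a (Fin.last (n + 1)) * r * a j.castSucc *
        C (Fin.last n).castSucc j.castSucc := Finset.sum_congr rfl fun j _ => by
    rw [hsymm (Fin.last n).castSucc]; ring
  have h3 : ∑ j : Fin (n + 1), ∑ k : Fin (n + 1), (if j = Fin.last n then
      a (Fin.last (n + 1)) * r * a k.castSucc * C j.castSucc k.castSucc else 0) =
      ∑ k : Fin (n + 1), a (Fin.last (n + 1)) * r * a k.castSucc *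
        C (Fin.last n).castSucc k.castSucc := by
    rw [Finset.sum_comm]
    simp only [Finset.sum_ite_eq', Finset.mem_univ, if_true]
  rw [h1, h2, h3]
  ring

/-- Concatenating standard Gaussian pairs with correlations `ρ i` gives the centered Gaussian
vector whose covariances `C` satisfy `C j (k + 1) = ρ k * C j k` for `j ≤ k`. -/
lemma hasNormalCharFun_concatenation {μ : ProbabilityMeasure ℝ}
    (hμ : (μ : Measure ℝ) = gaussianReal 0 1) :
    ∀ (n : ℕ) (ρ : Fin n → ℝ) (C : Fin (n + 1) → Fin (n + 1) → ℝ), (∀ i, |ρ i| ≤ 1) →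
      (∀ j, C j j = 1) → (∀ j k, C j k = C k j) →
      (∀ (j : Fin (n + 1)) (k : Fin n), j ≤ k.castSucc → C j k.succ = ρ k * C j k.castSucc) →
      HasNormalCharFun (concatenation μ n fun i => stdPair (ρ i) : Measure (Fin (n + 1) → ℝ)) C
  | 0, ρ, C, _, hdiag, _, _ => by
    intro a
    rw [concatenation, ProbabilityMeasure.toMeasure_map, hμ,
      integral_map (by fun_prop) (Continuous.aestronglyMeasurable (by fun_prop))]
    simp only [Fin.sum_univ_succ, Fin.sum_univ_zero, add_zero, hdiag, mul_one]
    rw [integral_cexp_mul_gaussianReal, pow_two]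
  | n + 1, ρ, C, hρ, hdiag, hsymm, hC => by
    have ih := hasNormalCharFun_concatenation hμ n (fun i => ρ i.castSucc)
      (fun j k => C j.castSucc k.castSucc) (fun i => hρ _) (fun j => hdiag _)
      (fun j k => hsymm _ _) fun j k hjk => by
        have := hC j.castSucc k.castSucc (by simpa [Fin.le_def] using hjk)
        rwa [Fin.succ_castSucc] at this
    have hlast := ih.map_eval (Fin.last n) (hdiag _)
    intro a
    rw [concatenation_succ_stdPair μ (fun i => stdPair (ρ i)) rfl hlast,
      integral_map (show Measurable fun p : (Fin (n + 1) → ℝ) × ℝ => (Fin.snoc (α := fun _ => ℝ) p.1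
        (ρ (Fin.last n) * p.1 (Fin.last n) + √(1 - ρ (Fin.last n) ^ 2) * p.2) :
          Fin (n + 2) → ℝ) from (measurable_snoc _).comp
        (f := fun p : (Fin (n + 1) → ℝ) × ℝ => (p.1, ρ (Fin.last n) * p.1 (Fin.last n) +
          √(1 - ρ (Fin.last n) ^ 2) * p.2)) (by fun_prop)).aemeasurable
        (Continuous.aestronglyMeasurable (by fun_prop))]
    set r := ρ (Fin.last n) with hr
    set b := a (Fin.last (n + 1)) with hb
    have hsplit : ∀ p : (Fin (n + 1) → ℝ) × ℝ, Complex.exp ((∑ j, a j *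
        (Fin.snoc (α := fun _ => ℝ) p.1 (r * p.1 (Fin.last n) + √(1 - r ^ 2) * p.2) :
          Fin (n + 2) → ℝ) j : ℝ) * Complex.I) =
        Complex.exp ((∑ j : Fin (n + 1), (a j.castSucc + if j = Fin.last n then b * r else 0) *
          p.1 j : ℝ) * Complex.I) *
        Complex.exp ((b * √(1 - r ^ 2) * p.2 : ℝ) * Complex.I) := fun p => by
      rw [← Complex.exp_add, ← add_mul, ← Complex.ofReal_add]
      congr 3
      rw [Fin.sum_univ_castSucc]
      simp only [Fin.snoc_castSucc, Fin.snoc_last, add_mul, ite_mul, zero_mul,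
        Finset.sum_add_distrib, Finset.sum_ite_eq', Finset.mem_univ, if_true, ← hb]
      ring
    simp_rw [hsplit]
    rw [integral_prod_mul (fun x : Fin (n + 1) → ℝ => Complex.exp ((∑ j : Fin (n + 1),
      (a j.castSucc + if j = Fin.last n then b * r else 0) * x j : ℝ) * Complex.I))
      (fun z : ℝ => Complex.exp ((b * √(1 - r ^ 2) * z : ℝ) * Complex.I)), ih,
      integral_cexp_mul_gaussianReal, ← Complex.exp_add, ← Complex.ofReal_add, mul_pow,
      Real.sq_sqrt (by nlinarith [hρ (Fin.last n), sq_abs r, abs_nonneg r])]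
    congr 2
    rw [sum_snoc_quadratic (r := r) hdiag hsymm fun j => ?_]
    · ring
    · have := hC j.castSucc (Fin.last n) (by simpa [Fin.le_def] using Nat.le_of_lt_succ j.2)
      rwa [Fin.succ_last] at this

/-- Concatenating standard Gaussian pairs multiplies their correlations. -/
lemma map_concatenation_stdPair {μ : ProbabilityMeasure ℝ}
    (hμ : (μ : Measure ℝ) = gaussianReal 0 1) (n : ℕ) (ρ : Fin n → ℝ)
    (hρ : ∀ i, |ρ i| ≤ 1) :
    (concatenation μ n fun i => stdPair (ρ i)).map (f := fun x => (x 0, x (Fin.last n)))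
      ((measurable_pi_apply _).prodMk (measurable_pi_apply _)).aemeasurable =
      stdPair (∏ i, ρ i) := by
  -- Extending the correlations to `ℕ` lets the covariance of coordinates `j` and `k` be written as
  -- a product over an interval of integers.
  set ρ' : ℕ → ℝ := fun i => if h : i < n then ρ ⟨i, h⟩ else 1 with hρ'
  have hρ'_apply : ∀ i : Fin n, ρ' i = ρ i := fun i => by simp [hρ']
  have hCF := hasNormalCharFun_concatenation hμ n ρ
    (fun j k => ∏ i ∈ Finset.Ico (min j k : ℕ) (max j k), ρ' i) hρ (fun j => by simp)
    (fun j k => by rw [min_comm, max_comm]) fun j k hjk => by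
      have hjk' : (j : ℕ) ≤ k := hjk
      simp only [Fin.val_succ, Fin.val_castSucc]
      rw [min_eq_left (by omega), max_eq_right (by omega), min_eq_left hjk', max_eq_right hjk',
        Finset.prod_Ico_succ_top hjk', hρ'_apply, mul_comm]
  have hprod : ∏ i ∈ Finset.range n, ρ' i = ∏ i, ρ i := by
    rw [Finset.prod_range]
    exact Finset.prod_congr rfl fun i _ => hρ'_apply i
  have hprod_le : |∏ i, ρ i| ≤ 1 := by
    rw [Finset.abs_prod]
    exact Finset.prod_le_one (fun i _ => abs_nonneg _) fun i _ => hρ i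
  refine eq_stdPair hprod_le fun a b => ?_
  rw [ProbabilityMeasure.toMeasure_map, integral_map
    ((measurable_pi_apply _).prodMk (measurable_pi_apply _)).aemeasurable
    (Continuous.aestronglyMeasurable (by fun_prop))]
  -- The two indicators are added because `0` and `Fin.last n` coincide when `n = 0`.
  have h := hCF fun j => (if j = 0 then a else 0) + if j = Fin.last n then b else 0
  simp only [add_mul, mul_add, ite_mul, mul_ite, zero_mul, mul_zero, Finset.sum_add_distrib,
    Finset.sum_ite_eq', Finset.mem_univ, if_true] at h
  rw [h]
  simp only [Fin.val_zero, Fin.val_last, min_self, max_self, Finset.Ico_self, Finset.prod_empty,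
    Nat.zero_min, Nat.min_zero, Nat.zero_max, Nat.max_zero, ← Finset.range_eq_Ico, hprod]
  ring_nf

/-- Composing the pair laws of a standardized Gaussian process along a partition multiplies the
correlations. -/
lemma IsCenteredGaussianMeasure.composedLaw_eq {T : Set ℝ} {K : ℝ → ℝ → ℝ}
    {P : ProbabilityMeasure (T → ℝ)} (hP : IsCenteredGaussianMeasure T K P)
    (hK : ∀ t ∈ T, K t t = 1) {s t : T} (R : TimePartition s t) :
    composedLaw P R = stdPair (∏ i : Fin R.size, K (R.pts i.castSucc) (R.pts i.succ)) := by
  rw [← map_concatenation_stdPair (hP.marginalLaw_eq hK (R.pts 0)) R.size _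
    fun i => hP.abs_le_one hK _ _]
  simp only [composedLaw, concatenatedLaw, hP.pairLaw_eq hK]

/-- A standardized centered Gaussian measure with multiplicative covariance function is Markov. -/
lemma IsCenteredGaussianMeasure.isMarkovMeasure {T : Set ℝ} {K : ℝ → ℝ → ℝ}
    {P : ProbabilityMeasure (T → ℝ)} (hP : IsCenteredGaussianMeasure T K P)
    (hK : ∀ t ∈ T, K t t = 1)
    (hmul : ∀ r s t : T, r ≤ s → s ≤ t → K r t = K r s * K s t) : IsMarkovMeasure P := by
  intro n t ht
  refine ProbabilityMeasure.toMeasure_injective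
    ((hP.hasNormalCharFun_finiteLaw t).measure_eq ?_)
  simp only [concatenatedLaw, hP.pairLaw_eq hK]
  refine hasNormalCharFun_concatenation (hP.marginalLaw_eq hK _) n _ _
    (fun i => hP.abs_le_one hK _ _) (fun j => hK _ (t j).2) (fun j k => hP.symm _ _)
    fun j k hjk => ?_
  rw [mul_comm]
  exact hmul _ _ _ (ht.monotone hjk) (ht.monotone (Fin.castSucc_lt_succ).le)

/-! ### Existence of Gaussian measures with multiplicative covariance -/

/-- The quadratic form of a multiplicative kernel dominates the squared correlation with any later
time. -/
lemma sq_sum_le_of_multiplicative {X : Type*} [LinearOrder X] {C : X → X → ℝ}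
    (hdiag : ∀ x, C x x = 1) (hsymm : ∀ x y, C x y = C y x) (hle : ∀ x y, |C x y| ≤ 1)
    (hmul : ∀ x y z, x ≤ y → y ≤ z → C x z = C x y * C y z) (f : X → ℝ) (s : Finset X) :
    ∀ m, (∀ x ∈ s, x ≤ m) →
      (∑ x ∈ s, C x m * f x) ^ 2 ≤ ∑ x ∈ s, ∑ y ∈ s, C x y * (f x * f y) := by
  induction s using Finset.induction_on_max with
  | empty => simp
  | insert M s hM ih =>
    intro m hm
    have hMs : M ∉ s := fun h => (hM M h).false
    have hMm : M ≤ m := hm M (Finset.mem_insert_self _ _)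
    have h1 : ∑ x ∈ insert M s, C x m * f x =
        C M m * (f M + ∑ x ∈ s, C x M * f x) := by
      rw [Finset.sum_insert hMs, mul_add, Finset.mul_sum]
      congr 1
      refine Finset.sum_congr rfl fun x hx => ?_
      rw [hmul x M m (hM x hx).le hMm]
      ring
    have h2 : ∑ x ∈ insert M s, ∑ y ∈ insert M s, C x y * (f x * f y) =
        f M ^ 2 + 2 * f M * (∑ x ∈ s, C x M * f x) + ∑ x ∈ s, ∑ y ∈ s, C x y * (f x * f y) := by
      have hc : ∑ x ∈ s, C M x * (f M * f x) = f M * ∑ x ∈ s, C x M * f x := by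
        rw [Finset.mul_sum]
        exact Finset.sum_congr rfl fun x _ => by rw [hsymm M x]; ring
      have hc' : ∑ x ∈ s, C x M * (f x * f M) = f M * ∑ x ∈ s, C x M * f x := by
        rw [Finset.mul_sum]
        exact Finset.sum_congr rfl fun x _ => by ring
      simp only [Finset.sum_insert hMs, Finset.sum_add_distrib]
      rw [hc, hc', hdiag]
      ring
    have h3 := ih M fun x hx => (hM x hx).le
    have h4 : C M m ^ 2 ≤ 1 := (sq_le_one_iff_abs_le_one _).2 (hle M m)
    -- With `S = ∑ C x M f x`, the induction hypothesis at `M` bounds the old form below by `S²`, so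
    -- the new form is at least `(f M + S)²`; multiplying by `C M m ^ 2 ≤ 1` only decreases this.
    rw [h1, h2, mul_pow]
    nlinarith [sq_nonneg (f M + ∑ x ∈ s, C x M * f x)]

/-- A symmetric kernel with nonnegative quadratic forms is the Gram kernel of a family of vectors
of a Hilbert space. -/
lemma exists_hilbert_features {X : Type} {C : X → X → ℝ} (hsymm : ∀ x y, C x y = C y x)
    (hpos : ∀ (s : Finset X) (f : X → ℝ), 0 ≤ ∑ x ∈ s, ∑ y ∈ s, C x y * (f x * f y)) :
    ∃ (H : Type) (_ : NormedAddCommGroup H) (_ : InnerProductSpace ℝ H) (_ : CompleteSpace H)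
      (φ : X → H), ∀ x y, inner ℝ (φ x) (φ y) = C x y := by
  -- The scalar kernel is viewed as operator-valued, acting on `ℝ` by multiplication; the features
  -- are the kernel sections of its reproducing kernel Hilbert space, evaluated at `1`.
  let K : Matrix X X (ℝ →L[ℝ] ℝ) := .of fun x y => C x y • ContinuousLinearMap.id ℝ ℝ
  have hherm : K.IsHermitian := by
    ext x y
    have : star (ContinuousLinearMap.id ℝ ℝ) = ContinuousLinearMap.id ℝ ℝ := star_one (ℝ →L[ℝ] ℝ)
    simp [K, Matrix.conjTranspose_apply, hsymm x y, this]
  have hK : K.PosSemidef := by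
    refine ((RKHS.posSemidef_tfae (K := K)).out 0 2).2 ?_
    refine ⟨hherm, fun v => ?_⟩
    have := hpos v.support v
    simp only [Finsupp.sum, K]
    convert this using 1
    simp
    exact Finset.sum_congr rfl fun x _ => Finset.sum_congr rfl fun y _ => by
      rw [hsymm y x]; ring
  have : Fact K.PosSemidef := ⟨hK⟩
  refine ⟨RKHS.OfKernel K, inferInstance, inferInstance, inferInstance,
    fun x => RKHS.kerFun (RKHS.OfKernel K) x 1, fun x y => ?_⟩
  rw [← RKHS.kernel_inner, RKHS.OfKernel.kernel_ofKernel]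
  simp [K, hsymm x y]

/-- For fixed `t`, the characteristic function of the law of `f` is `|t|`-Lipschitz in `f` for the
`L²` norm, because `|exp(ix) - exp(iy)| ≤ |x - y|` and the `L¹` norm is at most the `L²` norm. The
Gaussian characteristic function with variance `‖f‖²` is continuous in `f` too, so their equality
passes to the limit. -/
lemma gaussianReal_of_tendsto_Lp {Ω : Type} {mΩ : MeasurableSpace Ω} {P : Measure Ω}
    [IsProbabilityMeasure P] {W : Lp ℝ 2 P} {α : Type} {l : Filter α} [l.NeBot]
    {f : α → Lp ℝ 2 P} (hl : Tendsto f l (𝓝 W))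
    (h : ∀ i, P.map (f i) = gaussianReal 0 (‖f i‖₊ ^ 2)) :
    P.map W = gaussianReal 0 (‖W‖₊ ^ 2) := by
  have hm : ∀ f : Lp ℝ 2 P, AEMeasurable f P := fun f => (Lp.aestronglyMeasurable f).aemeasurable
  have := Measure.isProbabilityMeasure_map (hm W)
  refine Measure.ext_of_charFun (funext fun t => ?_)
  have hcont : Continuous fun f : Lp ℝ 2 P => charFun (P.map f) t := by
    have hbase : ∀ x y : ℝ, ‖Complex.exp (t * x * Complex.I) - Complex.exp (t * y * Complex.I)‖ ≤
        |t| * ‖x - y‖ := fun x y => by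
      have h1 : Complex.exp (t * x * Complex.I) - Complex.exp (t * y * Complex.I) =
          Complex.exp (Complex.I * (t * y : ℝ)) *
            (Complex.exp (Complex.I * (t * (x - y) : ℝ)) - 1) := by
        rw [mul_sub, mul_one, ← Complex.exp_add]
        push_cast
        ring_nf
      rw [h1, norm_mul, Complex.norm_exp_I_mul_ofReal, one_mul]
      refine Real.norm_exp_I_mul_ofReal_sub_one_le.trans ?_
      rw [norm_mul, Real.norm_eq_abs t]
    have hint : ∀ f : Lp ℝ 2 P, Integrable (fun ω => Complex.exp (t * f ω * Complex.I)) P :=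
      fun f => by
        refine Integrable.of_bound (C := 1) ?_ (.of_forall fun ω => ?_)
        · exact (show Continuous fun x : ℝ => Complex.exp (t * x * Complex.I) by fun_prop
            ).comp_aestronglyMeasurable (Lp.aestronglyMeasurable f)
        · rw [← Complex.ofReal_mul, Complex.norm_exp_ofReal_mul_I]
    refine (LipschitzWith.of_dist_le_mul (K := ‖t‖₊) fun f g => ?_).continuous
    rw [dist_eq_norm, dist_eq_norm, charFun_apply_real, charFun_apply_real,
      integral_map (hm f) (by fun_prop), integral_map (hm g) (by fun_prop),
      ← integral_sub (hint f) (hint g)]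
    have h1 : ∫ ω, ‖(f - g : Lp ℝ 2 P) ω‖ ∂P ≤ ‖f - g‖ := by
      rw [integral_norm_eq_lintegral_enorm (Lp.aestronglyMeasurable _), ← eLpNorm_one_eq_lintegral_enorm,
        Lp.norm_def]
      exact ENNReal.toReal_mono (Lp.eLpNorm_ne_top _)
        (eLpNorm_le_eLpNorm_of_exponent_le (by norm_num) (Lp.aestronglyMeasurable _))
    have hfg : ∀ᵐ ω ∂P, ‖f ω - g ω‖ = ‖(f - g : Lp ℝ 2 P) ω‖ := by
      filter_upwards [Lp.coeFn_sub f g] with ω hω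
      rw [hω, Pi.sub_apply]
    calc _ ≤ ∫ ω, ‖Complex.exp (t * f ω * Complex.I) - Complex.exp (t * g ω * Complex.I)‖ ∂P :=
          norm_integral_le_integral_norm _
      _ ≤ ∫ ω, |t| * ‖(f - g : Lp ℝ 2 P) ω‖ ∂P := by
          refine integral_mono_ae ((hint f).sub (hint g)).norm
            (((Lp.memLp (f - g)).integrable (by norm_num)).norm.const_mul _) ?_
          filter_upwards [hfg] with ω hω
          rw [← hω]
          exact hbase _ _
      _ = |t| * ∫ ω, ‖(f - g : Lp ℝ 2 P) ω‖ ∂P := integral_const_mul _ _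
      _ ≤ |t| * ‖f - g‖ := by gcongr
  have hcont' : Continuous fun f : Lp ℝ 2 P => charFun (gaussianReal 0 (‖f‖₊ ^ 2)) t := by
    simp only [charFun_gaussianReal]
    fun_prop
  refine tendsto_nhds_unique ((hcont.tendsto W).comp hl) ?_
  have := (hcont'.tendsto W).comp hl
  refine this.congr fun i => ?_
  simp only [Function.comp_apply, h]

lemma HasGaussianLaw.map_eq_of_Lp {Ω : Type} {mΩ : MeasurableSpace Ω} {P : Measure Ω}
    [IsProbabilityMeasure P] {f : Lp ℝ 2 P} (hf : HasGaussianLaw f P) (h0 : ∫ ω, f ω ∂P = 0) :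
    P.map f = gaussianReal 0 (‖f‖₊ ^ 2) := by
  rw [hf.map_eq_gaussianReal, h0, variance_of_integral_eq_zero hf.aemeasurable h0]
  congr 1
  have : ∫ ω, (f ^ 2 : Ω → ℝ) ω ∂P = ‖f‖ ^ 2 := by
    rw [← real_inner_self_eq_norm_sq, L2.inner_def]
    refine integral_congr_ae (.of_forall fun ω => ?_)
    simp [pow_two]
  have h2 : ∫ ω, f ω ^ 2 ∂P = ‖f‖ ^ 2 := this
  rw [h2]
  ext
  simp

/-- The isonormal Gaussian process of a real Hilbert space. -/
lemma exists_isonormal (H : Type) [NormedAddCommGroup H] [InnerProductSpace ℝ H]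
    [CompleteSpace H] :
    ∃ (Ω : Type) (_ : MeasurableSpace Ω) (P : Measure Ω) (_ : IsProbabilityMeasure P)
      (W : H →ₗᵢ[ℝ] Lp ℝ 2 P), ∀ h, P.map (W h) = gaussianReal 0 (‖h‖₊ ^ 2) := by
  classical
  obtain ⟨ι, b, -⟩ := exists_hilbertBasis ℝ H
  let P : Measure (ι → ℝ) := Measure.infinitePi fun _ => gaussianReal 0 1
  let X : ι → (ι → ℝ) → ℝ := fun i ω => ω i
  have hind : iIndepFun X P := iIndepFun_infinitePi (P := fun _ : ι => gaussianReal 0 1)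
    (X := fun _ x => x) fun _ => measurable_id
  have hlaw : ∀ i, P.map (X i) = gaussianReal 0 1 := fun i => by
    exact Measure.infinitePi_map_eval _ i
  have hG : ∀ i, HasGaussianLaw (X i) P := fun i => ⟨by rw [hlaw]; infer_instance⟩
  have hX : IsGaussianProcess X P := ⟨fun I =>
    iIndepFun.hasGaussianLaw (fun i : I => hG i) (hind.precomp Subtype.val_injective)⟩
  have hmean : ∀ i, ∫ ω, X i ω ∂P = 0 := fun i => by
    have : ∫ x, x ∂(P.map (X i)) = 0 := by rw [hlaw, integral_id_gaussianReal]
    rwa [integral_map (hG i).aemeasurable (by fun_prop)] at this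
  have hvar : ∀ i, Var[X i; P] = 1 := fun i => by
    have : Var[id; P.map (X i)] = 1 := by rw [hlaw, variance_id_gaussianReal]; rfl
    rwa [variance_map (by fun_prop) (hG i).aemeasurable] at this
  let ξ : ι → Lp ℝ 2 P := fun i => (hG i).memLp_two.toLp (X i)
  have hξ : ∀ i, ξ i =ᵐ[P] X i := fun i => MemLp.coeFn_toLp _
  have hinner : ∀ i j, inner ℝ (ξ i) (ξ j) = cov[X i, X j; P] := fun i j => by
    rw [covariance_eq_sub (hG i).memLp_two (hG j).memLp_two, hmean, zero_mul, sub_zero, L2.inner_def]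
    refine integral_congr_ae ?_
    filter_upwards [hξ i, hξ j] with ω h1 h2
    simp [h1, h2, mul_comm]
  have hON : Orthonormal ℝ ξ := by
    rw [orthonormal_iff_ite]
    intro i j
    rw [hinner]
    split_ifs with h
    · rw [h, covariance_self (hG j).aemeasurable, hvar]
    · exact (hind.indepFun h).covariance_eq_zero (hG i).memLp_two (hG j).memLp_two
  -- The i.i.d. normal coordinates are orthonormal in `L²`, and `W` sends the Hilbert basis to them.
  -- Each `W h` is thus an `L²` limit of finite Gaussian sums.
  let W : H →ₗᵢ[ℝ] Lp ℝ 2 P :=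
    hON.orthogonalFamily.linearIsometry.comp b.repr.toLinearIsometry
  refine ⟨ι → ℝ, inferInstance, P, inferInstance, W, fun h => ?_⟩
  obtain ⟨c, hsum⟩ : ∃ c : ι → ℝ, HasSum (fun i => c i • ξ i) (W h) :=
    ⟨b.repr h, hON.orthogonalFamily.hasSum_linearIsometry (b.repr h)⟩
  rw [← W.nnnorm_map h]
  have hae : ∀ s : Finset ι, (∑ i ∈ s, c i • ξ i : Lp ℝ 2 P) =ᵐ[P]
      fun ω => ∑ i ∈ s, c i • X i ω := fun s => by
    have h1 : ∀ᵐ ω ∂P, ∀ i ∈ s, (c i • ξ i : Lp ℝ 2 P) ω = c i • X i ω := by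
      rw [Finset.eventually_all]
      intro i _
      filter_upwards [Lp.coeFn_smul (c i) (ξ i), hξ i] with ω h1 h2
      rw [h1, Pi.smul_apply, h2]
    filter_upwards [h1, Lp.coeFn_finsetSum s fun i => c i • ξ i] with ω h1 h2
    rw [h2, Finset.sum_apply]
    exact Finset.sum_congr rfl h1
  refine gaussianReal_of_tendsto_Lp hsum fun s => HasGaussianLaw.map_eq_of_Lp ?_ ?_
  · exact (((hX.smul c).hasGaussianLaw_fun_sum (I := s)).congr (hae s).symm)
  · rw [integral_congr_ae (hae s), integral_finsetSum _ fun i _ =>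
      show Integrable (fun ω => c i • X i ω) P from (hG i).integrable.smul (c i)]
    refine Finset.sum_eq_zero fun i _ => ?_
    rw [integral_smul, hmean, smul_zero]

/-- A family of vectors of a Hilbert space is the covariance structure of a centered Gaussian
measure. -/
lemma exists_isCenteredGaussianMeasure {T : Set ℝ} {K : ℝ → ℝ → ℝ}
    (hsymm : ∀ x y : T, K x y = K y x)
    (hpos : ∀ (s : Finset T) (f : T → ℝ), 0 ≤ ∑ x ∈ s, ∑ y ∈ s, K x y * (f x * f y)) :
    ∃ P : ProbabilityMeasure (T → ℝ), IsCenteredGaussianMeasure T K P := by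
  obtain ⟨H, _, _, _, φ, hφ⟩ := exists_hilbert_features hsymm hpos
  obtain ⟨Ω, _, P, _, W, hW⟩ := exists_isonormal H
  have hm : ∀ t, AEMeasurable (W (φ t)) P := fun t => (Lp.aestronglyMeasurable _).aemeasurable
  -- Elements of `L²` are only classes; genuinely measurable representatives are chosen so that `ω ↦
  -- (X t ω)ₜ` is a measurable map into `ℝ^T`.
  let X : T → Ω → ℝ := fun t => (hm t).mk _
  have hXm : ∀ t, Measurable (X t) := fun t => (hm t).measurable_mk
  have hXW : ∀ t, X t =ᵐ[P] W (φ t) := fun t => (hm t).ae_eq_mk.symm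
  have hXG : IsGaussianProcess X P := by
    -- A linear functional of finitely many `X t` agrees almost everywhere with `W` of the same
    -- combination of the `φ t`, hence is a centered Gaussian.
    refine ⟨fun I => ⟨isGaussian_of_map_eq_gaussianReal fun L =>
      ⟨0, ‖∑ t : I, L (Pi.single t 1) • φ t‖₊ ^ 2, ?_⟩⟩⟩
    have hXI : Measurable fun ω => I.restrict fun t => X t ω :=
      measurable_pi_lambda _ fun t => hXm t
    rw [Measure.map_map L.continuous.measurable hXI, ← hW]
    refine Measure.map_congr ?_
    have h1 : ∀ᵐ ω ∂P, ∀ t : I, (L (Pi.single t 1) • W (φ t) : Lp ℝ 2 P) ω =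
        L (Pi.single t 1) • X t ω := by
      rw [eventually_all]
      intro t
      filter_upwards [Lp.coeFn_smul (L (Pi.single t 1)) (W (φ t)), hXW t] with ω h1 h2
      rw [h1, Pi.smul_apply, h2]
    rw [map_sum]
    simp_rw [map_smul]
    filter_upwards [h1, Lp.coeFn_finsetSum Finset.univ fun t : I =>
      L (Pi.single t 1) • W (φ t)] with ω h1 h2
    rw [h2, Finset.sum_apply, Finset.sum_congr rfl fun t _ => h1 t, Function.comp_apply]
    conv_lhs => rw [← Finset.univ_sum_single (I.restrict fun t => X t ω), map_sum]
    refine Finset.sum_congr rfl fun t _ => ?_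
    rw [smul_eq_mul, mul_comm, ← smul_eq_mul, ← map_smul, ← Pi.single_smul, smul_eq_mul, mul_one]
    rfl
  have hXmap : Measurable fun ω t => X t ω := measurable_pi_lambda _ hXm
  have hmean : ∀ t, ∫ ω, X t ω ∂P = 0 := fun t => by
    have h : ∫ x, x ∂(P.map (W (φ t))) = 0 := by rw [hW, integral_id_gaussianReal]
    rw [integral_map (hm t) (by fun_prop)] at h
    rw [← h]
    exact integral_congr_ae (hXW t)
  refine ⟨⟨P.map fun ω t => X t ω, Measure.isProbabilityMeasure_map hXmap.aemeasurable⟩,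
    ⟨fun I => ⟨?_⟩⟩, fun t => ?_, fun s t => ?_⟩
  · rw [ProbabilityMeasure.coe_mk, Measure.map_map (Finset.measurable_restrict I) hXmap]
    exact (hXG.hasGaussianLaw I).isGaussian_map
  · rw [ProbabilityMeasure.coe_mk, integral_map hXmap.aemeasurable
      (measurable_pi_apply t).aestronglyMeasurable]
    exact hmean t
  · rw [ProbabilityMeasure.coe_mk, covariance_map (measurable_pi_apply s).aestronglyMeasurable
      (measurable_pi_apply t).aestronglyMeasurable hXmap.aemeasurable]
    change cov[X s, X t; P] = _
    rw [covariance_eq_sub (hXG.hasGaussianLaw_eval s).memLp_two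
      (hXG.hasGaussianLaw_eval t).memLp_two, hmean, zero_mul, sub_zero, ← hφ s t,
      ← W.inner_map_map, L2.inner_def]
    refine integral_congr_ae ?_
    filter_upwards [hXW s, hXW t] with ω h1 h2
    simp [h1, h2, mul_comm]

/-- Existence of standardized Gaussian measures with a multiplicative covariance function. -/
lemma exists_isCenteredGaussianMeasure_of_multiplicative {T : Set ℝ} {K : ℝ → ℝ → ℝ}
    (hdiag : ∀ x : T, K x x = 1) (hsymm : ∀ x y : T, K x y = K y x)
    (hle : ∀ x y : T, |K x y| ≤ 1)
    (hmul : ∀ x y z : T, x ≤ y → y ≤ z → K x z = K x y * K y z) :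
    ∃ P : ProbabilityMeasure (T → ℝ), IsCenteredGaussianMeasure T K P := by
  refine exists_isCenteredGaussianMeasure hsymm fun s f => ?_
  rcases s.eq_empty_or_nonempty with rfl | hs
  · simp
  · exact (sq_nonneg _).trans (sq_sum_le_of_multiplicative (C := fun x y : T => K x y)
      hdiag hsymm hle hmul f s (s.max' hs) fun x hx => s.le_max' x hx)

/-! ### Uniqueness of the strong local Markov transform -/

/-- The partition of `[s, t]` into `n + 1` intervals of equal length. -/
def uniformPartition {T : Set ℝ} (hT : T.OrdConnected) {s t : T} (hst : s < t) (n : ℕ) :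
    TimePartition s t where
  size := n + 1
  pts i := ⟨s + (t - s) * (i / (n + 1 : ℕ)), hT.out s.2 t.2 (by
    have hst' : (s : ℝ) < t := hst
    have h0 : (0 : ℝ) ≤ i / (n + 1 : ℕ) := by positivity
    have h1 : (i : ℝ) / (n + 1 : ℕ) ≤ 1 := by
      rw [div_le_one (by positivity)]
      exact_mod_cast Nat.le_of_lt_succ i.2
    constructor <;> nlinarith)⟩
  strictMono i j hij := by
    have hst' : (0 : ℝ) < t - s := sub_pos.2 hst
    have hij' : ((i : ℕ) : ℝ) < (j : ℕ) := by exact_mod_cast hij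
    have hn : (0 : ℝ) < (n + 1 : ℕ) := by positivity
    rw [← Subtype.coe_lt_coe]
    simp only
    gcongr
  first_eq := by ext; simp
  last_eq := by
    ext
    have hn : ((n + 1 : ℕ) : ℝ) ≠ 0 := by positivity
    simp only [Fin.val_last]
    rw [div_self hn]
    ring

lemma tendsto_mesh_uniformPartition {T : Set ℝ} (hT : T.OrdConnected) {s t : T} (hst : s < t) :
    Tendsto (fun n => (uniformPartition hT hst n).mesh) atTop (𝓝 0) := by
  have hst' : (0 : ℝ) < t - s := sub_pos.2 hst
  have h : ∀ n, (uniformPartition hT hst n).mesh = (t - s) * (1 / ((n : ℝ) + 1)) := fun n => by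
    have : ∀ i : Fin (n + 1), |((uniformPartition hT hst n).pts i.succ : ℝ) -
        ((uniformPartition hT hst n).pts i.castSucc : ℝ)| = (t - s) * (1 / ((n : ℝ) + 1)) :=
      fun i => by
        have hn : (0 : ℝ) < (n : ℝ) + 1 := by positivity
        have : ((uniformPartition hT hst n).pts i.succ : ℝ) -
            ((uniformPartition hT hst n).pts i.castSucc : ℝ) = (t - s) * (1 / ((n : ℝ) + 1)) := by
          simp only [uniformPartition, Fin.val_succ, Fin.val_castSucc]
          push_cast
          field_simp
          ring
        rw [this, abs_of_nonneg (by positivity)]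
    have h2 : (uniformPartition hT hst n).mesh =
        ⨆ i : Fin (n + 1), |((uniformPartition hT hst n).pts i.succ : ℝ) -
          ((uniformPartition hT hst n).pts i.castSucc : ℝ)| := rfl
    rw [h2]
    simp_rw [this]
    exact ciSup_const
  simp_rw [h]
  simpa using tendsto_one_div_add_atTop_nhds_zero_nat.const_mul ((t : ℝ) - s)

lemma marginalLaw_eq_map_fst {T : Set ℝ} (P : ProbabilityMeasure (T → ℝ)) (s t : T) :
    (marginalLaw P s : Measure ℝ) = (pairLaw P s t : Measure (ℝ × ℝ)).fst := by
  rw [Measure.fst, pairLaw, marginalLaw, ProbabilityMeasure.toMeasure_map,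
    ProbabilityMeasure.toMeasure_map, Measure.map_map measurable_fst (by fun_prop)]
  rfl

lemma marginalLaw_eq_map_snd {T : Set ℝ} (P : ProbabilityMeasure (T → ℝ)) (s t : T) :
    (marginalLaw P t : Measure ℝ) = (pairLaw P s t : Measure (ℝ × ℝ)).snd := by
  rw [Measure.snd, pairLaw, marginalLaw, ProbabilityMeasure.toMeasure_map,
    ProbabilityMeasure.toMeasure_map, Measure.map_map measurable_snd (by fun_prop)]
  rfl

/-- A probability measure on `ℝ^T` is determined by its laws at increasing times. -/
lemma eq_of_finiteLaw_eq {T : Set ℝ} (hT : T.Nonempty) {P Q : ProbabilityMeasure (T → ℝ)}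
    (h : ∀ (n : ℕ) (t : Fin (n + 1) → T), StrictMono t → finiteLaw P t = finiteLaw Q t) :
    P = Q := by
  classical
  obtain ⟨t₀, ht₀⟩ := hT
  refine ProbabilityMeasure.toMeasure_injective ?_
  have hlim : ∀ R : ProbabilityMeasure (T → ℝ), IsProjectiveLimit (R : Measure (T → ℝ))
      fun I : Finset T => (R : Measure (T → ℝ)).map I.restrict := fun R I => rfl
  have key : ∀ I : Finset T, (P : Measure (T → ℝ)).map I.restrict =
      (Q : Measure (T → ℝ)).map I.restrict := fun I => by
    -- Adding a point makes the set of times nonempty, as `finiteLaw` is indexed by `Fin (n + 1)`.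
    set J := insert (⟨t₀, ht₀⟩ : T) I
    have hJ : J.card = (J.card - 1) + 1 :=
      (Nat.sub_add_cancel (Finset.card_pos.2 (Finset.insert_nonempty _ _))).symm
    let e := J.orderIsoOfFin hJ
    let g : (Fin (J.card - 1 + 1) → ℝ) → I → ℝ := fun x i =>
      x (e.symm ⟨i, Finset.mem_insert_of_mem i.2⟩)
    have hg : Measurable g := measurable_pi_lambda _ fun i => measurable_pi_apply _
    have hR : ∀ R : ProbabilityMeasure (T → ℝ), (R : Measure (T → ℝ)).map I.restrict =
        (finiteLaw R fun k => (e k : T) : Measure (Fin (J.card - 1 + 1) → ℝ)).map g := fun R => by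
      rw [finiteLaw, ProbabilityMeasure.toMeasure_map, Measure.map_map hg
        (measurable_pi_lambda _ fun i => measurable_pi_apply _)]
      congr 1
      ext ω i
      simp [g]
    rw [hR, hR, h _ _ fun a b hab => e.strictMono hab]
  have hQ := hlim Q
  have hP := hlim P
  simp_rw [key] at hP
  exact hP.unique hQ

/-- Limits along uniform partitions fix the pair laws. Each time has another one in `T` to be paired
with, so the one-dimensional marginals are fixed as well, and the Markov property gives all
finite-dimensional laws. -/
lemma IsStrongLocalMarkovTransform.unique {T : Set ℝ} (hT : T.OrdConnected)
    (hT_nontrivial : T.Nontrivial) {P P₁ P₂ : ProbabilityMeasure (T → ℝ)}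
    (h₁ : IsStrongLocalMarkovTransform P P₁) (h₂ : IsStrongLocalMarkovTransform P P₂) :
    P₁ = P₂ := by
  have hpair : ∀ s t : T, s < t → pairLaw P₁ s t = pairLaw P₂ s t := fun s t hst =>
    tendsto_nhds_unique (h₁.2 s t hst _ (tendsto_mesh_uniformPartition hT hst))
      (h₂.2 s t hst _ (tendsto_mesh_uniformPartition hT hst))
  have hmarg : ∀ t : T, marginalLaw P₁ t = marginalLaw P₂ t := fun t => by
    refine ProbabilityMeasure.toMeasure_injective ?_
    obtain ⟨u, hu, hut⟩ := hT_nontrivial.exists_ne (t : ℝ)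
    rcases lt_or_gt_of_ne hut with h | h
    · rw [marginalLaw_eq_map_snd P₁ ⟨u, hu⟩ t, marginalLaw_eq_map_snd P₂ ⟨u, hu⟩ t,
        hpair ⟨u, hu⟩ t h]
    · rw [marginalLaw_eq_map_fst P₁ t ⟨u, hu⟩, marginalLaw_eq_map_fst P₂ t ⟨u, hu⟩,
        hpair t ⟨u, hu⟩ h]
  refine eq_of_finiteLaw_eq hT_nontrivial.nonempty fun n t ht => ?_
  rw [h₁.1 n t ht, h₂.1 n t ht, concatenatedLaw, concatenatedLaw, hmarg]
  congr 1
  ext1 i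
  exact hpair _ _ (ht Fin.castSucc_lt_succ)

/-! ### The kernels `K_α` -/

lemma expKernel_nonneg (α : ℝ → ℝ≥0∞) (s t : ℝ) : 0 ≤ expKernel α s t := ENNReal.toReal_nonneg

lemma expKernel_self (α : ℝ → ℝ≥0∞) (s : ℝ) : expKernel α s s = 1 := by
  simp [expKernel]

lemma expKernel_symm (α : ℝ → ℝ≥0∞) (s t : ℝ) : expKernel α s t = expKernel α t s := by
  rw [expKernel, expKernel, min_comm, max_comm]

lemma exp_neg_coe_le_one (x : ℝ≥0∞) : EReal.exp (-(x : EReal)) ≤ 1 := by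
  rw [← EReal.exp_zero]
  exact EReal.exp_monotone (by simpa using EReal.coe_ennreal_nonneg x)

lemma expKernel_le_one (α : ℝ → ℝ≥0∞) (s t : ℝ) : |expKernel α s t| ≤ 1 := by
  rw [abs_of_nonneg (expKernel_nonneg _ _ _)]
  exact ENNReal.toReal_le_of_le_ofReal zero_le_one (by simpa using exp_neg_coe_le_one _)

/-- Half-open intervals concatenate disjointly, and they avoid the right endpoint, where `α` need
not be controlled. -/
lemma expKernel_of_le (α : ℝ → ℝ≥0∞) {s t : ℝ} (h : s ≤ t) :
    expKernel α s t = (EReal.exp (-((∫⁻ u in Set.Ico s t, α u : ℝ≥0∞) : EReal))).toReal := by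
  rw [expKernel, min_eq_left h, max_eq_right h, Measure.restrict_congr_set Ico_ae_eq_Icc]

lemma expKernel_mul (α : ℝ → ℝ≥0∞) {r s t : ℝ} (hrs : r ≤ s) (hst : s ≤ t) :
    expKernel α r t = expKernel α r s * expKernel α s t := by
  rw [expKernel_of_le α hrs, expKernel_of_le α hst, expKernel_of_le α (hrs.trans hst),
    ← ENNReal.toReal_mul, ← EReal.exp_add, ← Set.Ico_union_Ico_eq_Ico hrs hst,
    lintegral_union measurableSet_Ico (Set.Ico_disjoint_Ico_same)]
  congr 2
  rw [EReal.coe_ennreal_add, EReal.neg_add (by simp) (by simp), sub_eq_add_neg]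

/-- Common reduction for both halves of the theorem: all that is left is the convergence of products
of correlations. -/
lemma exists_isTheStrongLocalMarkovTransform {T : Set ℝ} (hT : T.OrdConnected)
    (hT_nontrivial : T.Nontrivial) {K : ℝ → ℝ → ℝ} (hK_var : ∀ t ∈ T, K t t = 1)
    {P : ProbabilityMeasure (T → ℝ)} (hP : IsCenteredGaussianMeasure T K P) (α : ℝ → ℝ≥0∞)
    (h : ∀ s t : T, s < t → ∀ R : ℕ → TimePartition s t,
      Tendsto (fun n => (R n).mesh) atTop (𝓝 0) →
        Tendsto (fun n => ∏ i : Fin (R n).size, K ((R n).pts i.castSucc) ((R n).pts i.succ)) atTop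
          (𝓝 (expKernel α s t))) :
    ∃ P' : ProbabilityMeasure (T → ℝ), IsCenteredGaussianMeasure T (expKernel α) P' ∧
      IsTheStrongLocalMarkovTransform P P' := by
  obtain ⟨P', hP'⟩ := exists_isCenteredGaussianMeasure_of_multiplicative (T := T)
    (K := expKernel α) (fun x => expKernel_self _ _) (fun x y => expKernel_symm _ _ _)
    (fun x y => expKernel_le_one _ _ _) (fun x y z hxy hyz => expKernel_mul α hxy hyz)
  have hP'T : IsStrongLocalMarkovTransform P P' := by
    refine ⟨hP'.isMarkovMeasure (fun t _ => expKernel_self _ _)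
      fun r s t hrs hst => expKernel_mul α hrs hst, fun s t hst R hR => ?_⟩
    rw [hP'.pairLaw_eq (fun t _ => expKernel_self _ _)]
    simp_rw [hP.composedLaw_eq hK_var]
    exact tendsto_stdPair (h s t hst R hR)
  exact ⟨P', hP', hP'T, fun Q hQ => hQ.unique hT hT_nontrivial hP'T⟩

/-! ### Infinitesimal products -/

lemma prod_one_sub_le_exp {n : ℕ} {q : Fin n → ℝ} (h1 : ∀ i, q i ≤ 1) :
    ∏ i, (1 - q i) ≤ Real.exp (-∑ i, q i) := by
  rw [← Finset.sum_neg_distrib, Real.exp_sum]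
  exact Finset.prod_le_prod (fun i _ => sub_nonneg.2 (h1 i)) fun i _ => Real.one_sub_le_exp_neg _

/-- Factor by factor, `log (1 - q) ≥ 1 - (1 - q)⁻¹ = -q / (1 - q) ≥ -(1 + 2ε) q`. The last
inequality uses `(1 + 2ε)(1 - ε) ≥ 1`, which for `ε ≥ 0` amounts to `ε ≤ 1/2`. -/
lemma exp_le_prod_one_sub {n : ℕ} {q : Fin n → ℝ} {ε : ℝ} (h0 : ∀ i, 0 ≤ q i)
    (hε : ε ≤ 1 / 2) (h1 : ∀ i, q i ≤ ε) :
    Real.exp (-((1 + 2 * ε) * ∑ i, q i)) ≤ ∏ i, (1 - q i) := by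
  rw [Finset.mul_sum, ← Finset.sum_neg_distrib, Real.exp_sum]
  refine Finset.prod_le_prod (fun i _ => (Real.exp_pos _).le) fun i _ => ?_
  have hq : 0 < 1 - q i := by linarith [h1 i]
  rw [← Real.le_log_iff_exp_le hq]
  refine le_trans ?_ (Real.one_sub_inv_le_log_of_pos hq)
  have : (1 - q i)⁻¹ ≤ 1 + (1 + 2 * ε) * q i := by
    rw [inv_le_iff_one_le_mul₀ hq]
    nlinarith [h0 i, h1 i, mul_nonneg (h0 i) (sub_nonneg.2 (h1 i)),
      mul_nonneg (mul_nonneg (h0 i) (h0 i)) (sub_nonneg.2 hε), mul_nonneg (h0 i) (h0 i)]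
  linarith

/-- Products of factors that tend uniformly to `1` converge to the exponential of minus the limit
of the sums of their defects. -/
lemma tendsto_prod_one_sub {m : ℕ → ℕ} {q : ∀ n, Fin (m n) → ℝ} {A : ℝ≥0∞}
    (h0 : ∀ n i, 0 ≤ q n i) (hsmall : ∀ ε > 0, ∀ᶠ n in atTop, ∀ i, q n i ≤ ε)
    (hsum : Tendsto (fun n => ∑ i, ENNReal.ofReal (q n i)) atTop (𝓝 A)) :
    Tendsto (fun n => ∏ i, (1 - q n i)) atTop (𝓝 (EReal.exp (-(A : EReal))).toReal) := by
  simp_rw [← ENNReal.ofReal_sum_of_nonneg fun i _ => h0 _ i] at hsum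
  have hpos : ∀ n, 0 ≤ ∑ i, q n i := fun n => Finset.sum_nonneg fun i _ => h0 n i
  induction A with
  | top =>
    have hsum' : Tendsto (fun n => ∑ i, q n i) atTop atTop := by
      rw [tendsto_atTop]
      intro M
      filter_upwards [hsum.eventually (lt_mem_nhds (b := ⊤) (a := ENNReal.ofReal M)
        ENNReal.ofReal_lt_top)] with n hn
      by_contra hlt
      exact hn.not_ge (ENNReal.ofReal_le_ofReal (not_le.1 hlt).le)
    have hlim := Real.tendsto_exp_atBot.comp (tendsto_neg_atTop_atBot.comp hsum')
    simp only [EReal.coe_ennreal_top, EReal.neg_top, EReal.exp_bot, ENNReal.toReal_zero]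
    refine tendsto_of_tendsto_of_tendsto_of_le_of_le' tendsto_const_nhds hlim ?_ ?_
    · filter_upwards [hsmall 1 one_pos] with n hn
      exact Finset.prod_nonneg fun i _ => sub_nonneg.2 (hn i)
    · filter_upwards [hsmall 1 one_pos] with n hn
      exact prod_one_sub_le_exp hn
  | coe A =>
    have hsum' : Tendsto (fun n => ∑ i, q n i) atTop (𝓝 A) := by
      have := (ENNReal.tendsto_toReal ENNReal.coe_ne_top).comp hsum
      refine this.congr fun n => ?_
      simp only [Function.comp_apply, ENNReal.toReal_ofReal (hpos n)]
    have hA : (EReal.exp (-((A : ℝ≥0∞) : EReal))).toReal = Real.exp (-A) := by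
      have : ((A : ℝ≥0∞) : EReal) = ((A : ℝ) : EReal) := rfl
      rw [this, ← EReal.coe_neg, EReal.exp_coe, ENNReal.toReal_ofReal (Real.exp_pos _).le]
    rw [hA, tendsto_order]
    constructor
    · intro a ha
      have hc : Tendsto (fun ε : ℝ => Real.exp (-((1 + 2 * ε) * A))) (𝓝[>] 0)
          (𝓝 (Real.exp (-A))) := by
        have : Continuous fun ε : ℝ => Real.exp (-((1 + 2 * ε) * A)) := by fun_prop
        simpa using (this.tendsto 0).mono_left nhdsWithin_le_nhds
      have hhalf : ∀ᶠ ε : ℝ in 𝓝[>] 0, ε ≤ 1 / 2 :=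
        nhdsWithin_le_nhds (eventually_le_nhds (by norm_num))
      -- `ε` is fixed before `n`, small enough that the limit of the lower bounds already exceeds
      -- `a`.
      obtain ⟨ε, hεa, hε, hε0⟩ := ((hc.eventually (lt_mem_nhds ha)).and
        (hhalf.and (eventually_mem_nhdsWithin (a := (0 : ℝ)) (s := Set.Ioi 0)))).exists
      have hc' : Tendsto (fun n => Real.exp (-((1 + 2 * ε) * ∑ i, q n i))) atTop
          (𝓝 (Real.exp (-((1 + 2 * ε) * A)))) :=
        (Real.continuous_exp.tendsto _).comp (hsum'.const_mul _).neg
      filter_upwards [hc'.eventually (lt_mem_nhds hεa), hsmall ε hε0] with n h1 h2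
      exact h1.trans_le (exp_le_prod_one_sub (h0 n) hε h2)
    · intro a ha
      have hc' : Tendsto (fun n => Real.exp (-∑ i, q n i)) atTop (𝓝 (Real.exp (-A))) :=
        (Real.continuous_exp.tendsto _).comp hsum'.neg
      filter_upwards [hc'.eventually (gt_mem_nhds ha), hsmall 1 one_pos] with n h1 h2
      exact (prod_one_sub_le_exp h2).trans_lt h1

/-! ### Riemann sums of unbounded functions -/

lemma sum_lintegral_Ico {n : ℕ} {p : Fin (n + 1) → ℝ} (hp : Monotone p) (g : ℝ → ℝ≥0∞) :
    ∑ i : Fin n, ∫⁻ x in Set.Ico (p i.castSucc) (p i.succ), g x =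
      ∫⁻ x in Set.Ico (p 0) (p (Fin.last n)), g x := by
  induction n with
  | zero => simp
  | succ n ih =>
    rw [Fin.sum_univ_castSucc]
    have := ih (p := fun i => p i.castSucc) fun i j hij => hp hij
    simp only [Fin.succ_castSucc] at this ⊢
    rw [this, Fin.succ_last, ← lintegral_union measurableSet_Ico Set.Ico_disjoint_Ico_same,
      Fin.castSucc_zero, Set.Ico_union_Ico_eq_Ico (hp (Fin.zero_le _)) (hp (Fin.le_last _))]

lemma exists_mem_Ico_of_mem {n : ℕ} (p : Fin (n + 1) → ℝ) {x : ℝ}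
    (hx : x ∈ Set.Ico (p 0) (p (Fin.last n))) :
    ∃ i : Fin n, x ∈ Set.Ico (p i.castSucc) (p i.succ) := by
  induction n with
  | zero => simp at hx
  | succ n ih =>
    rcases lt_or_ge x (p (Fin.last n).castSucc) with h | h
    · obtain ⟨i, hi⟩ := ih (fun i => p i.castSucc) ⟨hx.1, h⟩
      exact ⟨i.castSucc, hi⟩
    · exact ⟨Fin.last n, h, hx.2⟩

/-- The step function with value `a (p i)` on `[p i, p (i + 1))`. -/
def leftStep {n : ℕ} (p : Fin (n + 1) → ℝ) (a : ℝ → ℝ≥0∞) (x : ℝ) : ℝ≥0∞ :=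
  ∑ i : Fin n, (Set.Ico (p i.castSucc) (p i.succ)).indicator (fun _ => a (p i.castSucc)) x

lemma measurable_leftStep {n : ℕ} (p : Fin (n + 1) → ℝ) (a : ℝ → ℝ≥0∞) :
    Measurable (leftStep p a) :=
  Finset.measurable_fun_sum _ fun _ _ => measurable_const.indicator measurableSet_Ico

lemma leftStep_eq {n : ℕ} {p : Fin (n + 1) → ℝ} (hp : Monotone p) (a : ℝ → ℝ≥0∞) {x : ℝ}
    {i : Fin n} (hx : x ∈ Set.Ico (p i.castSucc) (p i.succ)) :
    leftStep p a x = a (p i.castSucc) := by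
  rw [leftStep, Finset.sum_eq_single i, Set.indicator_of_mem hx]
  · intro j _ hji
    refine Set.indicator_of_notMem (fun hj => ?_) _
    rcases lt_or_gt_of_ne hji with h | h
    · exact (hx.1.trans_lt hj.2).not_ge (hp (Fin.succ_le_castSucc_iff.2 h))
    · exact (hj.1.trans_lt hx.2).not_ge (hp (Fin.succ_le_castSucc_iff.2 h))
  · simp

lemma lintegral_comp_leftStep {n : ℕ} {p : Fin (n + 1) → ℝ} (hp : Monotone p) (a : ℝ → ℝ≥0∞)
    (G : ℝ≥0∞ → ℝ≥0∞) :
    ∫⁻ x in Set.Ico (p 0) (p (Fin.last n)), G (leftStep p a x) =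
      ∑ i : Fin n, G (a (p i.castSucc)) * ENNReal.ofReal (p i.succ - p i.castSucc) := by
  rw [← sum_lintegral_Ico hp]
  refine Finset.sum_congr rfl fun i _ => ?_
  rw [setLIntegral_congr_fun measurableSet_Ico fun x hx => by rw [leftStep_eq hp a hx],
    setLIntegral_const, Real.volume_Ico]

/-- Left Riemann sums of a nonnegative function `a` that is continuous on `[s, t)` converge to its
integral, finite or not, if `a v ≤ 4 a w + 7` as soon as `w` lies in the first quarter of a short
interval `[v, v + h] ⊆ [s, t]`. -/
lemma tendsto_sum_left {s t : ℝ} {a : ℝ → ℝ≥0∞} (ha : ContinuousOn a (Set.Ico s t))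
    (hfin : ∀ x, a x ≠ ⊤) {η : ℝ} (hη : 0 < η)
    (hcomp : ∀ v h w, s ≤ v → 0 < h → h ≤ η → v + h ≤ t → v ≤ w → w < v + h / 4 →
      a v ≤ 4 * a w + 7)
    {m : ℕ → ℕ} {p : ∀ n, Fin (m n + 1) → ℝ} (hp : ∀ n, StrictMono (p n)) (hp0 : ∀ n, p n 0 = s)
    (hpl : ∀ n, p n (Fin.last _) = t)
    (hmesh : ∀ δ > 0, ∀ᶠ n in atTop, ∀ i : Fin (m n), p n i.succ - p n i.castSucc ≤ δ) :
    Tendsto (fun n => ∑ i : Fin (m n),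
      a (p n i.castSucc) * ENNReal.ofReal (p n i.succ - p n i.castSucc)) atTop
      (𝓝 (∫⁻ x in Set.Ico s t, a x)) := by
  set μ := volume.restrict (Set.Ico s t) with hμ
  have ham : AEMeasurable a μ := ha.aemeasurable measurableSet_Ico
  have hint : ∀ n (G : ℝ≥0∞ → ℝ≥0∞), ∫⁻ x, G (leftStep (p n) a x) ∂μ = ∑ i : Fin (m n),
      G (a (p n i.castSucc)) * ENNReal.ofReal (p n i.succ - p n i.castSucc) := fun n G => by
    rw [← lintegral_comp_leftStep (hp n).monotone, hp0, hpl]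
  have hmem : ∀ n (i : Fin (m n)), s ≤ p n i.castSucc ∧ p n i.succ ≤ t := fun n i =>
    ⟨hp0 n ▸ (hp n).monotone (Fin.zero_le _), hpl n ▸ (hp n).monotone (Fin.le_last _)⟩
  have hptw : ∀ᵐ x ∂μ, Tendsto (fun n => leftStep (p n) a x) atTop (𝓝 (a x)) := by
    refine ae_restrict_of_forall_mem measurableSet_Ico fun x hx => ?_
    have hex : ∀ n, ∃ i : Fin (m n), x ∈ Set.Ico (p n i.castSucc) (p n i.succ) := fun n =>
      exists_mem_Ico_of_mem (p n) (by rwa [hp0, hpl])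
    choose i hi using hex
    simp_rw [fun n => leftStep_eq (hp n).monotone a (hi n)]
    refine (ha x hx).tendsto.comp (tendsto_nhdsWithin_iff.2 ⟨?_, .of_forall fun n => ?_⟩)
    · rw [Metric.tendsto_nhds]
      intro ε hε
      filter_upwards [hmesh (ε / 2) (half_pos hε)] with n hn
      rw [Real.dist_eq, abs_sub_comm, abs_of_nonneg (sub_nonneg.2 (hi n).1)]
      linarith [hn (i n), (hi n).2]
    · exact ⟨(hmem n _).1, (hi n).1.trans_lt hx.2⟩
  -- Fatou's lemma for the step functions, which converge pointwise by continuity; it also settles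
  -- the case of an infinite integral.
  have hlow : ∫⁻ x, a x ∂μ ≤ liminf (fun n => ∑ i : Fin (m n),
      a (p n i.castSucc) * ENNReal.ofReal (p n i.succ - p n i.castSucc)) atTop := by
    calc ∫⁻ x, a x ∂μ = ∫⁻ x, liminf (fun n => leftStep (p n) a x) atTop ∂μ :=
          lintegral_congr_ae (hptw.mono fun x hx => hx.liminf_eq.symm)
      _ ≤ liminf (fun n => ∫⁻ x, leftStep (p n) a x ∂μ) atTop :=
          lintegral_liminf_le' fun n => (measurable_leftStep _ _).aemeasurable
      _ = _ := congrArg (fun u => liminf u atTop) (funext fun n => hint n id)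
  rcases eq_or_ne (∫⁻ x, a x ∂μ) ⊤ with htop | htop
  · rw [htop] at hlow ⊢
    exact tendsto_of_le_liminf_of_limsup_le hlow le_top
  refine tendsto_of_le_liminf_of_limsup_le hlow ?_
  -- `c M` bounds, uniformly for fine partitions, the part of the Riemann sums above height `M`. It
  -- tends to `0` because `4 a + 7` is integrable.
  set c : ℕ → ℝ≥0∞ := fun M => 4 * ∫⁻ x, (4 * a x + 7 - M) ∂μ with hc
  have hc0 : Tendsto c atTop (𝓝 0) := by
    have : Tendsto (fun M : ℕ => ∫⁻ x, (4 * a x + 7 - M) ∂μ) atTop (𝓝 (∫⁻ _, 0 ∂μ)) := by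
      refine tendsto_lintegral_of_dominated_convergence' (fun x => 4 * a x + 7)
        (fun M => by fun_prop) (fun M => .of_forall fun x => tsub_le_self) ?_
        (.of_forall fun x => ?_)
      · rw [lintegral_add_right _ measurable_const, lintegral_const_mul'' _ ham, lintegral_const]
        exact ENNReal.add_ne_top.2 ⟨ENNReal.mul_ne_top (by norm_num) htop,
          ENNReal.mul_ne_top (by norm_num) (by simp [hμ])⟩
      · obtain ⟨N, hN⟩ := ENNReal.exists_nat_gt (r := 4 * a x + 7)
          (by simp [ENNReal.mul_eq_top, hfin x])
        refine tendsto_const_nhds.congr' ?_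
        filter_upwards [eventually_ge_atTop N] with M hM
        exact (tsub_eq_zero_of_le (hN.le.trans (by exact_mod_cast hM))).symm
    simp only [lintegral_zero] at this
    simpa [hc] using ENNReal.Tendsto.const_mul this (Or.inr (by norm_num))
  have hbound : ∀ M : ℕ, limsup (fun n => ∑ i : Fin (m n),
      a (p n i.castSucc) * ENNReal.ofReal (p n i.succ - p n i.castSucc)) atTop ≤
        ∫⁻ x, a x ∂μ + c M := fun M => by
    have hmin : Tendsto (fun n => ∫⁻ x, min (leftStep (p n) a x) M ∂μ) atTop
        (𝓝 (∫⁻ x, min (a x) M ∂μ)) := by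
      refine tendsto_lintegral_of_dominated_convergence (fun _ => (M : ℝ≥0∞))
        (fun n => (measurable_leftStep _ _).min measurable_const)
        (fun n => .of_forall fun x => min_le_right _ _) ?_ ?_
      · simp [hμ, ENNReal.mul_eq_top]
      · filter_upwards [hptw] with x hx
        exact hx.min tendsto_const_nhds
    have htail : ∀ᶠ n in atTop, ∫⁻ x, (leftStep (p n) a x - M) ∂μ ≤ c M := by
      filter_upwards [hmesh η hη] with n hn
      rw [hint n fun y => y - M]
      have hpiece : ∀ i : Fin (m n), (a (p n i.castSucc) - M) *
          ENNReal.ofReal (p n i.succ - p n i.castSucc) ≤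
          4 * ∫⁻ x in Set.Ico (p n i.castSucc) (p n i.succ), (4 * a x + 7 - M) := fun i => by
        set v := p n i.castSucc with hv
        set h := p n i.succ - v with hh
        have hpos : 0 < h := sub_pos.2 (hp n Fin.castSucc_lt_succ)
        have hvh : p n i.succ = v + h := by rw [hh]; ring
        -- The cell is traded for its first quarter, where `a v ≤ 4 a x + 7`; this is the source of
        -- the factor `4` in `c`.
        have h4 : ENNReal.ofReal h = 4 * volume (Set.Ico v (v + h / 4)) := by
          rw [Real.volume_Ico, add_sub_cancel_left, ← ENNReal.ofReal_ofNat 4,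
            ← ENNReal.ofReal_mul (by norm_num)]
          congr 1
          ring
        rw [h4, mul_left_comm, ← setLIntegral_const, hvh]
        gcongr 4 * ?_
        calc ∫⁻ _ in Set.Ico v (v + h / 4), (a v - M) ≤
            ∫⁻ x in Set.Ico v (v + h / 4), (4 * a x + 7 - M) := by
              refine setLIntegral_mono' measurableSet_Ico fun x hx => ?_
              gcongr
              exact hcomp v h x (hmem n i).1 hpos (hn i) (hvh ▸ (hmem n i).2) hx.1 hx.2
          _ ≤ _ := lintegral_mono_set (Set.Ico_subset_Ico_right (by linarith))
      refine (Finset.sum_le_sum fun i _ => hpiece i).trans ?_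
      rw [← Finset.mul_sum, sum_lintegral_Ico (hp n).monotone, hp0, hpl]
    have hle : ∀ᶠ n in atTop, ∑ i : Fin (m n), a (p n i.castSucc) *
        ENNReal.ofReal (p n i.succ - p n i.castSucc) ≤
          ∫⁻ x, min (leftStep (p n) a x) M ∂μ + c M := by
      filter_upwards [htail] with n hn
      have := hint n id
      simp only [id] at this
      rw [← this]
      -- The step function is cut at height `M`: the truncation is handled by dominated convergence,
      -- the excess by `htail`.
      calc ∫⁻ x, leftStep (p n) a x ∂μ ≤
          ∫⁻ x, (min (leftStep (p n) a x) M + (leftStep (p n) a x - M)) ∂μ := by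
            refine lintegral_mono fun x => ?_
            rcases le_total (leftStep (p n) a x) M with h | h
            · simp [h]
            · simp [h, add_tsub_cancel_of_le h]
        _ = ∫⁻ x, min (leftStep (p n) a x) M ∂μ + ∫⁻ x, (leftStep (p n) a x - M) ∂μ :=
            lintegral_add_left ((measurable_leftStep _ _).min measurable_const) _
        _ ≤ _ := by gcongr
    calc _ ≤ limsup (fun n => ∫⁻ x, min (leftStep (p n) a x) M ∂μ + c M) atTop :=
          limsup_le_limsup hle
      _ = ∫⁻ x, min (a x) M ∂μ + c M := (hmin.add tendsto_const_nhds).limsup_eq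
      _ ≤ ∫⁻ x, a x ∂μ + c M := by
          gcongr
          exact min_le_left _ _
  have hlim : Tendsto (fun M => ∫⁻ x, a x ∂μ + c M) atTop (𝓝 (∫⁻ x, a x ∂μ)) := by
    simpa using (tendsto_const_nhds (x := ∫⁻ x, a x ∂μ)).add hc0
  exact ge_of_tendsto' hlim hbound

/-- The limit may be `⊤`, so the comparison is additive in both directions and goes through `liminf`
and `limsup`, not through differences. -/
lemma tendsto_of_forall_approx {S U : ℕ → ℝ≥0∞} {A : ℝ≥0∞} (hS : Tendsto S atTop (𝓝 A))
    (h : ∀ ε : ℝ, 0 < ε → ∀ᶠ n in atTop, U n ≤ S n + ENNReal.ofReal ε ∧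
      S n ≤ U n + ENNReal.ofReal ε) : Tendsto U atTop (𝓝 A) := by
  refine tendsto_of_le_liminf_of_limsup_le ?_ ?_
  · refine ENNReal.le_of_forall_pos_le_add fun ε hε _ => ?_
    have h1 : Tendsto (fun n => S n - ε) atTop (𝓝 (A - ε)) :=
      ENNReal.Tendsto.sub hS tendsto_const_nhds (Or.inr ENNReal.coe_ne_top)
    rw [← tsub_le_iff_right, ← h1.liminf_eq]
    refine liminf_le_liminf ?_
    filter_upwards [h ε hε] with n hn
    rw [tsub_le_iff_right]
    simpa using hn.2
  · refine ENNReal.le_of_forall_pos_le_add fun ε hε _ => ?_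
    have h1 : Tendsto (fun n => S n + ε) atTop (𝓝 (A + ε)) := hS.add tendsto_const_nhds
    rw [← h1.limsup_eq]
    refine limsup_le_limsup ?_
    filter_upwards [h ε hε] with n hn
    simpa using hn.1

/-! ### Correlation kernels -/

/-- Here `1 - K u w` is half the squared distance between the standardized variables at `u` and `w`,
and `‖x + y‖² ≤ 2‖x‖² + 2‖y‖²`. The test vector `(1, -2, 1)` expresses exactly this. -/
lemma IsPosSemidefKernel.one_sub_le {T : Set ℝ} {K : ℝ → ℝ → ℝ} (hK : IsPosSemidefKernel T K)
    (hK_var : ∀ t ∈ T, K t t = 1) {u v w : ℝ} (hu : u ∈ T) (hv : v ∈ T) (hw : w ∈ T) :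
    1 - K u w ≤ 2 * (1 - K u v) + 2 * (1 - K v w) := by
  have hsymm : ∀ x ∈ T, ∀ y ∈ T, K x y = K y x := fun x hx y hy => by
    have := (hK 2 ![⟨x, hx⟩, ⟨y, hy⟩]).isHermitian.apply 0 1
    simpa using this.symm
  have h := (hK 3 ![⟨u, hu⟩, ⟨v, hv⟩, ⟨w, hw⟩]).dotProduct_mulVec_nonneg ![1, -2, 1]
  simp [Matrix.mulVec, dotProduct, Fin.sum_univ_three, hK_var u hu, hK_var v hv, hK_var w hw,
    hsymm v hv u hu, hsymm w hw u hu, hsymm w hw v hv] at h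
  linarith

lemma decayRate_eq {T : Set ℝ} {K : ℝ → ℝ → ℝ} (hK_var : ∀ t ∈ T, K t t = 1) {v h : ℝ}
    (hv : v ∈ T) (hvh : v + h ∈ T) : decayRate K v h = h⁻¹ * (1 - K v (v + h)) := by
  simp [decayRate, correlationFn, hK_var v hv, hK_var _ hvh]

lemma one_sub_eq_mul_decayRate {T : Set ℝ} {K : ℝ → ℝ → ℝ} (hK_var : ∀ t ∈ T, K t t = 1)
    {v h : ℝ} (hv : v ∈ T) (hvh : v + h ∈ T) (hh : 0 < h) :
    1 - K v (v + h) = h * decayRate K v h := by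
  rw [decayRate_eq hK_var hv hvh, mul_inv_cancel_left₀ hh.ne']

/-! ### Cells and mesh of a partition -/

lemma TimePartition.sub_le_mesh {T : Set ℝ} {s t : T} (R : TimePartition s t) (i : Fin R.size) :
    (R.pts i.succ : ℝ) - R.pts i.castSucc ≤ R.mesh :=
  (le_abs_self _).trans (le_ciSup (f := fun i : Fin R.size =>
    |(R.pts i.succ : ℝ) - (R.pts i.castSucc : ℝ)|) (Set.finite_range _).bddAbove i)

lemma sum_succ_sub_castSucc {n : ℕ} (p : Fin (n + 1) → ℝ) :
    ∑ i : Fin n, (p i.succ - p i.castSucc) = p (Fin.last n) - p 0 := by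
  induction n with
  | zero => simp
  | succ n ih =>
    have := ih fun i => p i.castSucc
    simp only [Fin.sum_univ_castSucc, Fin.succ_castSucc, Fin.succ_last, Fin.castSucc_zero]
      at this ⊢
    linarith

lemma TimePartition.sum_sub {T : Set ℝ} {s t : T} (R : TimePartition s t) :
    ∑ i : Fin R.size, ((R.pts i.succ : ℝ) - R.pts i.castSucc) = t - s := by
  rw [sum_succ_sub_castSucc fun i => (R.pts i : ℝ), R.first_eq, R.last_eq]

lemma TimePartition.castSucc_lt_succ {T : Set ℝ} {s t : T} (R : TimePartition s t)
    (i : Fin R.size) : (R.pts i.castSucc : ℝ) < R.pts i.succ :=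
  R.strictMono Fin.castSucc_lt_succ

lemma TimePartition.left_le {T : Set ℝ} {s t : T} (R : TimePartition s t)
    (i : Fin (R.size + 1)) : (s : ℝ) ≤ R.pts i :=
  R.first_eq.symm.le.trans (R.strictMono.monotone (Fin.zero_le _))

lemma TimePartition.le_right {T : Set ℝ} {s t : T} (R : TimePartition s t)
    (i : Fin (R.size + 1)) : (R.pts i : ℝ) ≤ t :=
  (R.strictMono.monotone (Fin.le_last _)).trans R.last_eq.le

lemma TimePartition.mem_incrementSet {T : Set ℝ} {s t : T} (R : TimePartition s t) {η : ℝ}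
    (hη : R.mesh ≤ η) (i : Fin R.size) : ((R.pts i.castSucc : ℝ),
      (R.pts i.succ : ℝ) - R.pts i.castSucc) ∈ incrementSet s t η := by
  have h := R.castSucc_lt_succ i
  refine ⟨⟨R.left_le _, h.trans_le (R.le_right _)⟩, ?_, sub_pos.2 h,
    (R.sub_le_mesh i).trans hη⟩
  simp only [add_sub_cancel]
  exact ⟨R.left_le _, R.le_right _⟩

/-! ### Sums of correlation defects along fine partitions -/

lemma eventually_one_sub_le {T : Set ℝ} (hT : T.OrdConnected) {K : ℝ → ℝ → ℝ}
    (hK_cont : ContinuousOn (Function.uncurry K) (T ×ˢ T)) (hK_var : ∀ t ∈ T, K t t = 1)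
    {s t : T} {R : ℕ → TimePartition s t} (hR : Tendsto (fun n => (R n).mesh) atTop (𝓝 0))
    {ε : ℝ} (hε : 0 < ε) :
    ∀ᶠ n in atTop, ∀ i : Fin (R n).size,
      1 - K ((R n).pts i.castSucc) ((R n).pts i.succ) ≤ ε := by
  have hsub : Set.Icc (s : ℝ) t ⊆ T := hT.out s.2 t.2
  have huc := (isCompact_Icc.prod isCompact_Icc).uniformContinuousOn_of_continuous
    (hK_cont.mono (Set.prod_mono hsub hsub))
  obtain ⟨δ, hδ, h⟩ := Metric.uniformContinuousOn_iff.1 huc ε hε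
  filter_upwards [hR.eventually (gt_mem_nhds hδ)] with n hn i
  have hlt := (R n).castSucc_lt_succ i
  have hx : ((R n).pts i.castSucc : ℝ) ∈ Set.Icc (s : ℝ) t := ⟨(R n).left_le _, (R n).le_right _⟩
  have hy : ((R n).pts i.succ : ℝ) ∈ Set.Icc (s : ℝ) t := ⟨(R n).left_le _, (R n).le_right _⟩
  have := h _ (Set.mk_mem_prod hx hx) _ (Set.mk_mem_prod hx hy) (by
    rw [Prod.dist_eq, dist_self, max_eq_right dist_nonneg, Real.dist_eq, abs_sub_comm,
      abs_of_pos (sub_pos.2 hlt)]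
    exact ((R n).sub_le_mesh i).trans_lt hn)
  rw [Real.dist_eq, Function.uncurry_apply_pair, Function.uncurry_apply_pair,
    hK_var _ ((R n).pts _).2] at this
  exact (le_abs_self _).trans this.le

/-- The product of the correlations along partitions converges to `K_α` once the sums of their
defects do. -/
lemma tendsto_prod_of_tendsto_sum {T : Set ℝ} (hT : T.OrdConnected) {K : ℝ → ℝ → ℝ}
    (hK_cont : ContinuousOn (Function.uncurry K) (T ×ˢ T)) (hK_var : ∀ t ∈ T, K t t = 1)
    (hK_le : ∀ x y : T, |K x y| ≤ 1) {α : ℝ → ℝ≥0∞} {s t : T} (hst : s < t)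
    {R : ℕ → TimePartition s t} (hR : Tendsto (fun n => (R n).mesh) atTop (𝓝 0))
    (hsum : Tendsto (fun n => ∑ i : Fin (R n).size,
      ENNReal.ofReal (1 - K ((R n).pts i.castSucc) ((R n).pts i.succ))) atTop
        (𝓝 (∫⁻ u in Set.Ico (s : ℝ) t, α u))) :
    Tendsto (fun n => ∏ i : Fin (R n).size, K ((R n).pts i.castSucc) ((R n).pts i.succ)) atTop
      (𝓝 (expKernel α s t)) := by
  rw [expKernel_of_le α (le_of_lt hst : (s : ℝ) ≤ t)]
  have := tendsto_prod_one_sub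
    (q := fun n i => 1 - K ((R n).pts i.castSucc) ((R n).pts i.succ))
    (fun n i => sub_nonneg.2 ((le_abs_self _).trans (hK_le _ _)))
    (fun ε hε => eventually_one_sub_le hT hK_cont hK_var hR hε) hsum
  simpa only [sub_sub_cancel] using this

/-- Once the decay rate exceeds `(x + 1) / (t - s)` on every cell, the defects sum to at least `x +
1`, as the cell lengths add up to `t - s`. -/
lemma tendsto_sum_of_decayRate_tendsto_top {T : Set ℝ} {K : ℝ → ℝ → ℝ}
    (hK_var : ∀ t ∈ T, K t t = 1) {s t : T} (hst : s < t)
    (h : Tendsto (fun η : ℝ => ⨅ p ∈ incrementSet s t η, ((decayRate K p.1 p.2 : ℝ) : EReal))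
      (𝓝[>] 0) (𝓝 ⊤))
    {R : ℕ → TimePartition s t} (hR : Tendsto (fun n => (R n).mesh) atTop (𝓝 0)) :
    Tendsto (fun n => ∑ i : Fin (R n).size,
      ENNReal.ofReal (1 - K ((R n).pts i.castSucc) ((R n).pts i.succ))) atTop (𝓝 ⊤) := by
  have hst' : (0 : ℝ) < t - s := sub_pos.2 hst
  rw [ENNReal.tendsto_nhds_top_iff_nnreal]
  intro x
  obtain ⟨η, hη, hη0⟩ := ((h.eventually (lt_mem_nhds
    (EReal.coe_lt_top (((x : ℝ) + 1) / (t - s))))).and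
    (eventually_mem_nhdsWithin (a := (0 : ℝ)) (s := Set.Ioi 0))).exists
  filter_upwards [hR.eventually (gt_mem_nhds hη0)] with n hn
  have hle : ∀ i : Fin (R n).size, ((x : ℝ) + 1) / (t - s) *
      ((R n).pts i.succ - (R n).pts i.castSucc) ≤
        1 - K ((R n).pts i.castSucc) ((R n).pts i.succ) := fun i => by
    have hmem := (R n).mem_incrementSet hn.le i
    have h1 : ((((x : ℝ) + 1) / (t - s) : ℝ) : EReal) < (decayRate K _ _ : ℝ) :=
      hη.trans_le (iInf₂_le _ hmem)
    have h2 := EReal.coe_lt_coe_iff.1 h1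
    have hpos := sub_pos.2 ((R n).castSucc_lt_succ i)
    have h3 := one_sub_eq_mul_decayRate hK_var ((R n).pts i.castSucc).2
      (h := (R n).pts i.succ - (R n).pts i.castSucc) (by simp) hpos
    rw [add_sub_cancel] at h3
    rw [h3, mul_comm]
    gcongr
  calc (x : ℝ≥0∞) < ENNReal.ofReal ((x : ℝ) + 1) := by
        rw [← ENNReal.ofReal_coe_nnreal]
        exact (ENNReal.ofReal_lt_ofReal_iff (by positivity)).2 (by linarith)
    _ = ∑ i : Fin (R n).size, ENNReal.ofReal (((x : ℝ) + 1) / (t - s) *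
      ((R n).pts i.succ - (R n).pts i.castSucc)) := by
        rw [← ENNReal.ofReal_sum_of_nonneg fun i _ => mul_nonneg (by positivity)
          (sub_pos.2 ((R n).castSucc_lt_succ i)).le, ← Finset.mul_sum, (R n).sum_sub,
          div_mul_cancel₀ _ hst'.ne']
    _ ≤ _ := Finset.sum_le_sum fun i _ => ENNReal.ofReal_le_ofReal (hle i)

lemma IsInstantaneousDecorrelationRate.nonneg {T : Set ℝ} (hT : T.OrdConnected)
    {K : ℝ → ℝ → ℝ} (hK_var : ∀ t ∈ T, K t t = 1) (hK_le : ∀ x y : T, |K x y| ≤ 1) {α : ℝ → ℝ}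
    (hα : IsInstantaneousDecorrelationRate T K α) {v : ℝ} (hv : v ∈ withoutSup T) : 0 ≤ α v := by
  obtain ⟨hvT, u, hu, hvu⟩ := hv
  refine ge_of_tendsto (hα v ⟨hvT, u, hu, hvu⟩) ?_
  filter_upwards [Ioo_mem_nhdsGT (sub_pos.2 hvu)] with h hh
  have hvh : v + h ∈ T := hT.out hvT hu ⟨by linarith [hh.1], by linarith [hh.2]⟩
  rw [decayRate_eq hK_var hvT hvh]
  exact mul_nonneg (inv_nonneg.2 hh.1.le)
    (sub_nonneg.2 ((le_abs_self _).trans (hK_le ⟨v, hvT⟩ ⟨_, hvh⟩)))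

lemma tendsto_sum_of_decayRate_tendsto {T : Set ℝ} (hT : T.OrdConnected) {K : ℝ → ℝ → ℝ}
    (hK : IsPosSemidefKernel T K) (hK_var : ∀ t ∈ T, K t t = 1)
    (hK_le : ∀ x y : T, |K x y| ≤ 1) {α : ℝ → ℝ}
    (hα : IsInstantaneousDecorrelationRate T K α) (hα_cont : ContinuousOn α (withoutSup T))
    {s t : T} (hst : s < t)
    (h : Tendsto (fun η : ℝ =>
      ⨆ p ∈ incrementSet s t η, ((|decayRate K p.1 p.2 - α p.1| : ℝ) : EReal)) (𝓝[>] 0) (𝓝 0))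
    {R : ℕ → TimePartition s t} (hR : Tendsto (fun n => (R n).mesh) atTop (𝓝 0)) :
    Tendsto (fun n => ∑ i : Fin (R n).size,
      ENNReal.ofReal (1 - K ((R n).pts i.castSucc) ((R n).pts i.succ))) atTop
        (𝓝 (∫⁻ u in Set.Ico (s : ℝ) t, ENNReal.ofReal (α u))) := by
  have hst' : (0 : ℝ) < t - s := sub_pos.2 hst
  have hsub : Set.Icc (s : ℝ) t ⊆ T := hT.out s.2 t.2
  have hsub' : Set.Ico (s : ℝ) t ⊆ withoutSup T := fun v hv =>
    ⟨hsub ⟨hv.1, hv.2.le⟩, t, t.2, hv.2⟩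
  have hα0 : ∀ v ∈ Set.Ico (s : ℝ) t, 0 ≤ α v := fun v hv => hα.nonneg hT hK_var hK_le (hsub' hv)
  -- The uniform convergence of the decay rates, multiplied by the increment: an error `ε (w - v)`
  -- on each cell adds up to `ε (t - s)`.
  have hunif : ∀ ε : ℝ, 0 < ε → ∃ η > 0, ∀ v w : ℝ, s ≤ v → v < w → w ≤ t → w - v ≤ η →
      |1 - K v w - α v * (w - v)| ≤ ε * (w - v) := fun ε hε => by
    obtain ⟨η, hη, hη0⟩ := ((h.eventually (gt_mem_nhds (EReal.coe_pos.2 hε))).and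
      (eventually_mem_nhdsWithin (a := (0 : ℝ)) (s := Set.Ioi 0))).exists
    refine ⟨η, hη0, fun v w hsv hvw hwt hvwη => ?_⟩
    have hmem : (v, w - v) ∈ incrementSet s t η :=
      ⟨⟨hsv, hvw.trans_le hwt⟩, by simpa using ⟨hsv.trans hvw.le, hwt⟩, sub_pos.2 hvw, hvwη⟩
    have h1 : ((|decayRate K v (w - v) - α v| : ℝ) : EReal) < (ε : ℝ) :=
      (le_iSup₂ (f := fun (p : ℝ × ℝ) (_ : p ∈ incrementSet s t η) =>
        ((|decayRate K p.1 p.2 - α p.1| : ℝ) : EReal)) _ hmem).trans_lt hη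
    have h2 := EReal.coe_lt_coe_iff.1 h1
    have hw : v + (w - v) ∈ T := by
      rw [add_sub_cancel]
      exact hsub ⟨hsv.trans hvw.le, hwt⟩
    have h3 := one_sub_eq_mul_decayRate hK_var (hsub ⟨hsv, hvw.le.trans hwt⟩) hw (sub_pos.2 hvw)
    rw [add_sub_cancel] at h3
    rw [h3, mul_comm (α v), ← mul_sub, abs_mul, abs_of_pos (sub_pos.2 hvw), mul_comm ε]
    exact mul_le_mul_of_nonneg_left h2.le (sub_pos.2 hvw).le
  obtain ⟨η, hη, hη1⟩ := hunif 1 one_pos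
  have hmesh : ∀ δ > 0, ∀ᶠ n in atTop, ∀ i : Fin (R n).size,
      ((R n).pts i.succ : ℝ) - (R n).pts i.castSucc ≤ δ := fun δ hδ => by
    filter_upwards [hR.eventually (gt_mem_nhds hδ)] with n hn i
    exact ((R n).sub_le_mesh i).trans hn.le
  have hS := tendsto_sum_left (s := (s : ℝ)) (t := t) (a := fun u => ENNReal.ofReal (α u))
    (ENNReal.continuous_ofReal.comp_continuousOn (hα_cont.mono hsub'))
    (fun _ => ENNReal.ofReal_ne_top) hη (fun v h w hsv hh hhη hvt hvw hwv => by
      have hw0 := hα0 w ⟨hsv.trans hvw, by linarith⟩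
      -- With error `1` in `hunif`, the three-point inequality at `v < w < v + h` gives `(α v - 1) h
      -- ≤ 2 (α v + 1) (w - v) + 2 (α w + 1) (v + h - w)`. Since `w - v ≤ h / 4`, half of `α v h`
      -- can be absorbed on the left, leaving `α v ≤ 4 α w + 7`.
      have hreal : α v ≤ 4 * α w + 7 := by
        rcases hvw.eq_or_lt with rfl | hvw
        · linarith
        have hk := hK.one_sub_le hK_var (hsub ⟨hsv, by linarith⟩ : v ∈ T)
          (hsub ⟨hsv.trans hvw.le, by linarith⟩ : w ∈ T)
          (hsub ⟨by linarith, hvt⟩ : v + h ∈ T)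
        have h1 := abs_le.1 (hη1 v (v + h) hsv (by linarith) hvt (by linarith))
        have h2 := abs_le.1 (hη1 v w hsv hvw (by linarith) (by linarith))
        have h3 := abs_le.1 (hη1 w (v + h) (hsv.trans hvw.le) (by linarith) hvt (by linarith))
        have hv0 := hα0 v ⟨hsv, by linarith⟩
        have h4 : (α v + 1) * (w - v) ≤ (α v + 1) * (h / 4) := by
          gcongr
          linarith
        have h5 : (α w + 1) * (v + h - w) ≤ (α w + 1) * h := by
          gcongr
          linarith
        have h6 : α v * h ≤ (4 * α w + 7) * h := by nlinarith
        exact le_of_mul_le_mul_right h6 hh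
      calc ENNReal.ofReal (α v) ≤ ENNReal.ofReal (4 * α w + 7) := ENNReal.ofReal_le_ofReal hreal
        _ = 4 * ENNReal.ofReal (α w) + 7 := by
          rw [ENNReal.ofReal_add (by positivity) (by norm_num),
            ENNReal.ofReal_mul (by norm_num), ENNReal.ofReal_ofNat, ENNReal.ofReal_ofNat])
    (m := fun n => (R n).size) (p := fun n i => ((R n).pts i : ℝ))
    (fun n i j hij => (R n).strictMono hij) (fun n => congrArg _ (R n).first_eq)
    (fun n => congrArg _ (R n).last_eq) hmesh
  refine tendsto_of_forall_approx hS fun ε hε => ?_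
  obtain ⟨δ, hδ, hδε⟩ := hunif (ε / (t - s)) (div_pos hε hst')
  filter_upwards [hmesh δ hδ] with n hn
  have hpos : ∀ i : Fin (R n).size, (0 : ℝ) < (R n).pts i.succ - (R n).pts i.castSucc := fun i =>
    sub_pos.2 ((R n).castSucc_lt_succ i)
  have hsum : ENNReal.ofReal ε = ∑ i : Fin (R n).size,
      ENNReal.ofReal (ε / (t - s) * ((R n).pts i.succ - (R n).pts i.castSucc)) := by
    rw [← ENNReal.ofReal_sum_of_nonneg fun i _ => mul_nonneg (by positivity) (hpos i).le,
      ← Finset.mul_sum, (R n).sum_sub, div_mul_cancel₀ _ hst'.ne']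
  have hi : ∀ i : Fin (R n).size, |1 - K ((R n).pts i.castSucc) ((R n).pts i.succ) -
      α ((R n).pts i.castSucc) * ((R n).pts i.succ - (R n).pts i.castSucc)| ≤
      ε / (t - s) * ((R n).pts i.succ - (R n).pts i.castSucc) := fun i =>
    hδε _ _ ((R n).left_le _) ((R n).castSucc_lt_succ i) ((R n).le_right _) (hn i)
  have hαi : ∀ i : Fin (R n).size, 0 ≤ α ((R n).pts i.castSucc) := fun i =>
    hα0 _ ⟨(R n).left_le _, ((R n).castSucc_lt_succ i).trans_le ((R n).le_right _)⟩
  constructor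
  · rw [hsum, ← Finset.sum_add_distrib]
    refine Finset.sum_le_sum fun i _ => ?_
    rw [← ENNReal.ofReal_mul (hαi i), ← ENNReal.ofReal_add (mul_nonneg (hαi i) (hpos i).le)
      (mul_nonneg (by positivity) (hpos i).le)]
    exact ENNReal.ofReal_le_ofReal (by linarith [(abs_le.1 (hi i)).2])
  · rw [hsum, ← Finset.sum_add_distrib]
    refine Finset.sum_le_sum fun i _ => ?_
    rw [← ENNReal.ofReal_mul (hαi i), ← ENNReal.ofReal_add
      (sub_nonneg.2 ((le_abs_self _).trans (hK_le _ _)))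
      (mul_nonneg (by positivity) (hpos i).le)]
    exact ENNReal.ofReal_le_ofReal (by linarith [(abs_le.1 (hi i)).1])

end

theorem theorem4 (T : Set ℝ) (hT : T.OrdConnected) (hT_nontrivial : T.Nontrivial)
    (K : ℝ → ℝ → ℝ) (hK : IsPosSemidefKernel T K)
    (hK_cont : ContinuousOn (Function.uncurry K) (T ×ˢ T))
    (hK_var : ∀ t ∈ T, K t t = 1)
    (P : ProbabilityMeasure (T → ℝ)) (hP : IsCenteredGaussianMeasure T K P) :
    (∀ α : ℝ → ℝ, IsInstantaneousDecorrelationRate T K α → ContinuousOn α (withoutSup T) →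
      (∀ s ∈ T, ∀ t ∈ T, s < t →
        Tendsto (fun η : ℝ =>
            ⨆ p ∈ incrementSet s t η, ((|decayRate K p.1 p.2 - α p.1| : ℝ) : EReal))
          (𝓝[>] 0) (𝓝 0)) →
      ∃ Pα : ProbabilityMeasure (T → ℝ),
        IsCenteredGaussianMeasure T (expKernel fun u => ENNReal.ofReal (α u)) Pα ∧
        IsTheStrongLocalMarkovTransform P Pα) ∧
    ((∀ s ∈ T, ∀ t ∈ T, s < t →
        Tendsto (fun η : ℝ => ⨅ p ∈ incrementSet s t η, ((decayRate K p.1 p.2 : ℝ) : EReal))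
          (𝓝[>] 0) (𝓝 ⊤)) →
      ∃ Pinf : ProbabilityMeasure (T → ℝ),
        IsCenteredGaussianMeasure T (expKernel fun _ => ⊤) Pinf ∧
        IsTheStrongLocalMarkovTransform P Pinf) := by
  have hK_le : ∀ x y : T, |K x y| ≤ 1 := hP.abs_le_one hK_var
  constructor
  · intro α hα hα_cont h
    refine exists_isTheStrongLocalMarkovTransform hT hT_nontrivial hK_var hP _
      fun s t hst R hR => ?_
    exact tendsto_prod_of_tendsto_sum hT hK_cont hK_var hK_le hst hR
      (tendsto_sum_of_decayRate_tendsto hT hK hK_var hK_le hα hα_cont hst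
        (h s s.2 t t.2 hst) hR)
  · intro h
    refine exists_isTheStrongLocalMarkovTransform hT hT_nontrivial hK_var hP _
      fun s t hst R hR => ?_
    refine tendsto_prod_of_tendsto_sum hT hK_cont hK_var hK_le hst hR ?_
    have hst' : (0 : ℝ) < t - s := sub_pos.2 hst
    have htop : ∫⁻ _ in Set.Ico (s : ℝ) t, (⊤ : ℝ≥0∞) = ⊤ := by
      rw [setLIntegral_const, Real.volume_Ico, ENNReal.top_mul (by simpa using hst)]
    rw [htop]
    exact tendsto_sum_of_decayRate_tendsto_top hK_var hst (h s s.2 t t.2 hst) hR
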